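/- Let $k$ be a field, let $G$ be an affine algebraic group over $k$ (an affine group scheme of finite type) with an endomorphism $\sigma$ that is a universal homeomorphism, and let $K\subset G$ be a closed subgroup such that $\sigma$ restricts to an endomorphism of $K$. Let $$X=\frac{G}{\mathrm{Ad}_\sigma K},\qquad Y=\frac{G}{\mathrm{Ad}_\sigma G}$$ be the fpqc quotient stacks over $k$ for the actions $h\cdot g=\sigma(h)gh^{-1}$ of $K$ and of $G$ on $G$, and let $f:X\to Y$ be the natural map. Let $X_2=\frac{G\times^K G}{\mathrm{Ad}_\sigma K}$ be the quotient stack of $G\times G$ by the action of $K\times K$ given by $$(k_1,k_2)\cdot(g_1,g_2)=(\sigma(k_1)g_1k_2^{-1},\,k_2g_2k_1^{-1}).$$ Let $m:X_2\to X$ be the multiplication map, induced by $(g_1,g_2)\mapsto g_1g_2$ (and $(k_1,k_2)\mapsto k_1$), and let ${}_{\mathrm p}\sigma:X_2\to X_2$ be the partial $\sigma$-map, induced by $(g_1,g_2)\mapsto(\sigma(g_2),g_1)$ (and $(k_1,k_2)\mapsto(k_2,\sigma(k_1))$). Then there is a canonical isomorphism (equivalence of stacks over $k$) $e: X\times_Y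 X\cong X_2$, where the left-hand side is the 2-fibre product along $f$, together with 2-isomorphisms identifying the left projection $X\times_YX\to X$ with $m\circ{}_{\mathrm p}\sigma\circ e$ and the right projection $X\times_YX\to X$ with $m\circ e$. Here "canonical" means that, under these identifications, the tautological 2-isomorphism between the two maps $X\times_YX\rightrightarrows X\to Y$ becomes the 2-isomorphism from $f\circ m\circ{}_{\mathrm p}\sigma$ to $f\circ m$ that is given on the atlas $G\times G\to X_2$ by the element $g_2\in G$ (note $\sigma(g_2)g_1=\sigma(g_2)(g_1g_2)g_2^{-1}$). -/

import Mathlib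

open CategoryTheory Opposite AlgebraicGeometry

universe w v u u'

namespace QuotientStack

/-! ## Quotient stacks over a site -/

section Site

variable {C : Type u} [Category.{v} C]

/-- Restriction of a section `x` of a presheaf along `f : V ⟶ U`. -/
def res (F : Cᵒᵖ ⥤ Type w) {U V : C} (f : V ⟶ U) (x : F.obj (op U)) : F.obj (op V) :=
  F.map f.op x

theorem res_id (F : Cᵒᵖ ⥤ Type w) {U : C} (x : F.obj (op U)) : res F (𝟙 U) x = x := by
  simp [res]

theorem res_comp (F : Cᵒᵖ ⥤ Type w) {U V W : C} (g : W ⟶ V) (f : V ⟶ U) (x : F.obj (op U)) :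
    res F (g ≫ f) x = res F g (res F f x) := by
  simp [res]

/-- A sheaf of groups `H` on the site `(C, J)` together with a left action on a sheaf `Z`. -/
structure GroupAction (J : GrothendieckTopology C) where
  H : Cᵒᵖ ⥤ Type v
  Z : Cᵒᵖ ⥤ Type v
  [group : ∀ U : C, Group (H.obj (op U))]
  [mulAction : ∀ U : C, MulAction (H.obj (op U)) (Z.obj (op U))]
  res_mul : ∀ {U V : C} (f : V ⟶ U) (g h : H.obj (op U)),
    res H f (g * h) = res H f g * res H f h
  res_smul : ∀ {U V : C} (f : V ⟶ U) (g : H.obj (op U)) (z : Z.obj (op U)),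
    res Z f (g • z) = res H f g • res Z f z
  isSheaf_H : Presieve.IsSheaf J H
  isSheaf_Z : Presieve.IsSheaf J Z

attribute [instance] GroupAction.group GroupAction.mulAction

variable {J : GrothendieckTopology C}

theorem GroupAction.res_one (A : GroupAction J) {U V : C} (f : V ⟶ U) :
    res A.H f (1 : A.H.obj (op U)) = 1 := by
  have h := A.res_mul f 1 1
  rw [mul_one] at h
  exact (left_eq_mul.mp h)

theorem GroupAction.res_inv (A : GroupAction J) {U V : C} (f : V ⟶ U) (h : A.H.obj (op U)) :
    res A.H f h⁻¹ = (res A.H f h)⁻¹ := by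
  apply eq_inv_of_mul_eq_one_left
  rw [← A.res_mul, inv_mul_cancel, A.res_one]

/-- A morphism of group actions `(H, Z) → (H', Z')`: a homomorphism of sheaves of groups
`H → H'` and a map `Z → Z'` of sheaves that is equivariant along it. -/
structure ActionHom (A B : GroupAction J) where
  onGroup : ∀ U : C, A.H.obj (op U) →* B.H.obj (op U)
  onGroup_res : ∀ {U V : C} (f : V ⟶ U) (h : A.H.obj (op U)),
    onGroup V (res A.H f h) = res B.H f (onGroup U h)
  onSpace : ∀ U : C, A.Z.obj (op U) → B.Z.obj (op U)
  onSpace_res : ∀ {U V : C} (f : V ⟶ U) (z : A.Z.obj (op U)),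
    onSpace V (res A.Z f z) = res B.Z f (onSpace U z)
  onSpace_smul : ∀ {U : C} (h : A.H.obj (op U)) (z : A.Z.obj (op U)),
    onSpace U (h • z) = onGroup U h • onSpace U z

/-- An object of the quotient stack `[Z/H]` over `T = base`: an `H`-torsor `P → T` on the site
together with an `H`-equivariant map `P → Z`. Here `P` is a sheaf with a left action of `H` and an
invariant map `proj` to (the sheaf represented by) `T`, such that `H` acts simply transitively on
the sections of `P` over any given `U ⟶ T`, and such sections exist locally on `U`. (The sets
`P.obj U` may be large only for formal reasons: the fibre over a given `U ⟶ T` is empty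
or in bijection with `H.obj U`.) -/
structure QuotObj (A : GroupAction J) where
  base : C
  P : Cᵒᵖ ⥤ Type (max u v)
  isSheaf : Presieve.IsSheaf J P
  [mulAction : ∀ U : C, MulAction (A.H.obj (op U)) (P.obj (op U))]
  res_smul : ∀ {U V : C} (f : V ⟶ U) (h : A.H.obj (op U)) (p : P.obj (op U)),
    res P f (h • p) = res A.H f h • res P f p
  proj : ∀ {U : C}, P.obj (op U) → (U ⟶ base)
  proj_res : ∀ {U V : C} (f : V ⟶ U) (p : P.obj (op U)), proj (res P f p) = f ≫ proj p
  proj_smul : ∀ {U : C} (h : A.H.obj (op U)) (p : P.obj (op U)), proj (h • p) = proj p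
  simplyTransitive : ∀ {U : C} (p q : P.obj (op U)), proj p = proj q → ∃! h : A.H.obj (op U), h • p = q
  locallyNonempty : ∀ {U : C} (t : U ⟶ base), ∃ S ∈ J U, ∀ ⦃V : C⦄ (f : V ⟶ U), S f →
    ∃ p : P.obj (op V), proj p = f ≫ t
  toSpace : ∀ {U : C}, P.obj (op U) → A.Z.obj (op U)
  toSpace_res : ∀ {U V : C} (f : V ⟶ U) (p : P.obj (op U)),
    toSpace (res P f p) = res A.Z f (toSpace p)
  toSpace_smul : ∀ {U : C} (h : A.H.obj (op U)) (p : P.obj (op U)),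
    toSpace (h • p) = h • toSpace p

attribute [instance] QuotObj.mulAction

/-- A morphism of `[Z/H]`: a morphism of bases `T ⟶ T'` and an equivariant map `P → P'` over it
that is compatible with the maps to `Z`. -/
@[ext]
structure QuotHom {A : GroupAction J} (Q R : QuotObj A) where
  base : Q.base ⟶ R.base
  map : ∀ U : C, Q.P.obj (op U) → R.P.obj (op U)
  map_res : ∀ {U V : C} (f : V ⟶ U) (p : Q.P.obj (op U)), map V (res Q.P f p) = res R.P f (map U p)
  map_smul : ∀ {U : C} (h : A.H.obj (op U)) (p : Q.P.obj (op U)), map U (h • p) = h • map U p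
  proj_map : ∀ {U : C} (p : Q.P.obj (op U)), R.proj (map U p) = Q.proj p ≫ base
  toSpace_map : ∀ {U : C} (p : Q.P.obj (op U)), R.toSpace (map U p) = Q.toSpace p

instance (A : GroupAction J) : Category (QuotObj A) where
  Hom Q R := QuotHom Q R
  id Q :=
    { base := 𝟙 _
      map := fun _ p => p
      map_res := fun _ _ => rfl
      map_smul := fun _ _ => rfl
      proj_map := fun _ => (Category.comp_id _).symm
      toSpace_map := fun _ => rfl }
  comp a b :=
    { base := a.base ≫ b.base
      map := fun U p => b.map U (a.map U p)
      map_res := fun f p => by rw [a.map_res, b.map_res]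
      map_smul := fun h p => by rw [a.map_smul, b.map_smul]
      proj_map := fun p => by rw [b.proj_map, a.proj_map, Category.assoc]
      toSpace_map := fun p => by rw [b.toSpace_map, a.toSpace_map] }
  id_comp a := QuotHom.ext (Category.id_comp _) rfl
  comp_id a := QuotHom.ext (Category.comp_id _) rfl
  assoc a b c := QuotHom.ext (Category.assoc _ _ _) rfl

theorem QuotObj.hom_ext {A : GroupAction J} {Q R : QuotObj A} {a b : Q ⟶ R}
    (h : a.base = b.base) (h' : ∀ (U : C) (p : Q.P.obj (op U)), a.map U p = b.map U p) : a = b :=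
  QuotHom.ext h (funext fun U => funext fun p => h' U p)

/-- The quotient stack `[Z/H]`, as a category over `C`. -/
def quotientStack (A : GroupAction J) : BasedCategory.{max u v, max (u + 1) (v + 1)} C :=
  BasedCategory.ofFunctor (𝒳 := QuotObj A)
    { obj := fun Q => Q.base
      map := fun a => a.base
      map_id := fun _ => rfl
      map_comp := fun _ _ => rfl }

/-- Sections of a sheaf can be defined locally by invariant functions on a torsor. -/
theorem QuotObj.descend {A : GroupAction J} (Q : QuotObj A) {F : Cᵒᵖ ⥤ Type w}
    (hF : Presieve.IsSheaf J F) {U : C} (t : U ⟶ Q.base)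
    (s : ∀ {V : C} (f : V ⟶ U) (p : Q.P.obj (op V)), Q.proj p = f ≫ t → F.obj (op V))
    (s_res : ∀ {V W : C} (g : W ⟶ V) (f : V ⟶ U) (p : Q.P.obj (op V)) (hp : Q.proj p = f ≫ t)
      (hp' : Q.proj (res Q.P g p) = (g ≫ f) ≫ t),
      s (g ≫ f) (res Q.P g p) hp' = res F g (s f p hp))
    (s_smul : ∀ {V : C} (f : V ⟶ U) (h : A.H.obj (op V)) (p : Q.P.obj (op V))
      (hp : Q.proj p = f ≫ t) (hp' : Q.proj (h • p) = f ≫ t), s f (h • p) hp' = s f p hp) :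
    ∃! x : F.obj (op U), ∀ {V : C} (f : V ⟶ U) (p : Q.P.obj (op V)) (hp : Q.proj p = f ≫ t),
      res F f x = s f p hp := by
  have s_indep : ∀ {V : C} (f f' : V ⟶ U) (p q : Q.P.obj (op V)) (hp : Q.proj p = f ≫ t)
      (hq : Q.proj q = f' ≫ t), f = f' → s f p hp = s f' q hq := by
    intro V f f' p q hp hq e
    subst e
    obtain ⟨h, rfl, -⟩ := Q.simplyTransitive p q (hp.trans hq.symm)
    exact (s_smul f h p hp hq).symm
  obtain ⟨S, hS, hne⟩ := Q.locallyNonempty t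
  choose pt hpt using hne
  let x : Presieve.FamilyOfElements F S.arrows := fun V f hf => s f (pt f hf) (hpt f hf)
  have hx : x.Compatible := by
    intro Y₁ Y₂ Z g₁ g₂ f₁ f₂ h₁ h₂ e
    have e₁ : Q.proj (res Q.P g₁ (pt f₁ h₁)) = (g₁ ≫ f₁) ≫ t := by
      rw [Q.proj_res, hpt, Category.assoc]
    have e₂ : Q.proj (res Q.P g₂ (pt f₂ h₂)) = (g₂ ≫ f₂) ≫ t := by
      rw [Q.proj_res, hpt, Category.assoc]
    exact ((s_res g₁ f₁ _ (hpt f₁ h₁) e₁).symm.trans (s_indep _ _ _ _ e₁ e₂ e)).trans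
      (s_res g₂ f₂ _ (hpt f₂ h₂) e₂)
  obtain ⟨y, hy, hu⟩ := hF S hS x hx
  refine ⟨y, ?_, ?_⟩
  · intro V f p hp
    refine (hF.isSeparated _ (J.pullback_stable f hS)).ext ?_
    intro W g hg
    have e₁ : Q.proj (res Q.P g p) = (g ≫ f) ≫ t := by rw [Q.proj_res, hp, Category.assoc]
    change res F g (res F f y) = res F g (s f p hp)
    rw [← res_comp, ← s_res g f p hp e₁]
    exact (hy (g ≫ f) hg).trans (s_indep _ _ _ _ _ _ rfl)
  · intro z hz
    exact hu z fun V f hf => hz f (pt f hf) (hpt f hf)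

/-- A map of torsors along a morphism `φ` of group actions, compatible with the maps to the
spaces acted upon. -/
structure TorsorMap {A B : GroupAction J} (φ : ActionHom A B) (Q : QuotObj A) (R : QuotObj B) where
  base : Q.base ⟶ R.base
  map : ∀ U : C, Q.P.obj (op U) → R.P.obj (op U)
  map_res : ∀ {U V : C} (f : V ⟶ U) (p : Q.P.obj (op U)), map V (res Q.P f p) = res R.P f (map U p)
  map_smul : ∀ {U : C} (h : A.H.obj (op U)) (p : Q.P.obj (op U)),
    map U (h • p) = φ.onGroup U h • map U p
  proj_map : ∀ {U : C} (p : Q.P.obj (op U)), R.proj (map U p) = Q.proj p ≫ base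
  toSpace_map : ∀ {U : C} (p : Q.P.obj (op U)), R.toSpace (map U p) = φ.onSpace U (Q.toSpace p)

/-! ### The morphism of quotient stacks induced by a morphism of group actions

It sends `(P, P → Z)` to the contracted product `H' ×^H P` with the induced map to `Z'`. A section
of `H' ×^H P` over `t : U ⟶ T` has the form `[s(p), p]` for every local section `p` of `P` over `t`,
for a unique function `s` with `s(h p) = s(p) h⁻¹`. This describes its sections without a
sheafification. -/

/-- Sections over `U` of the contracted product `H' ×^H P`. -/
structure IndSec {A B : GroupAction J} (φ : ActionHom A B) (Q : QuotObj A) (U : C) where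
  pt : U ⟶ Q.base
  fn : ∀ {V : C} (f : V ⟶ U) (p : Q.P.obj (op V)), Q.proj p = f ≫ pt → B.H.obj (op V)
  fn_res : ∀ {V W : C} (g : W ⟶ V) (f : V ⟶ U) (p : Q.P.obj (op V)) (hp : Q.proj p = f ≫ pt)
    (hp' : Q.proj (res Q.P g p) = (g ≫ f) ≫ pt),
    fn (g ≫ f) (res Q.P g p) hp' = res B.H g (fn f p hp)
  fn_smul : ∀ {V : C} (f : V ⟶ U) (h : A.H.obj (op V)) (p : Q.P.obj (op V))
    (hp : Q.proj p = f ≫ pt) (hp' : Q.proj (h • p) = f ≫ pt),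
    fn f (h • p) hp' = fn f p hp * (φ.onGroup V h)⁻¹

section Induced

variable {A B : GroupAction J} {φ : ActionHom A B} {Q : QuotObj A}

theorem IndSec.ext' {U : C} {x y : IndSec φ Q U} (h : x.pt = y.pt)
    (h' : ∀ {V : C} (f : V ⟶ U) (p : Q.P.obj (op V)) (hp : Q.proj p = f ≫ x.pt)
      (hp' : Q.proj p = f ≫ y.pt), x.fn f p hp = y.fn f p hp') : x = y := by
  obtain ⟨t, s, _, _⟩ := x
  obtain ⟨t', s', _, _⟩ := y
  obtain rfl : t = t' := h
  congr 1
  funext V f p hp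
  exact h' f p hp hp

theorem IndSec.fn_congr {U : C} {x y : IndSec φ Q U} (h : x = y) {V : C} {f f' : V ⟶ U}
    (hf : f = f') {p p' : Q.P.obj (op V)} (hpp : p = p') (hp : Q.proj p = f ≫ x.pt)
    (hp' : Q.proj p' = f' ≫ y.pt) : x.fn f p hp = y.fn f' p' hp' := by
  subst h hf hpp
  rfl

/-- Restriction of sections of the contracted product. -/
def IndSec.restrict {U V : C} (g : V ⟶ U) (x : IndSec φ Q U) : IndSec φ Q V where
  pt := g ≫ x.pt
  fn f p hp := x.fn (f ≫ g) p (by rw [hp, Category.assoc])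
  fn_res g' f p hp hp' := by
    rw [← x.fn_res g' (f ≫ g) p (by rw [hp, Category.assoc])
      (by rw [hp', Category.assoc, Category.assoc, Category.assoc])]
    exact IndSec.fn_congr rfl (Category.assoc _ _ _) rfl _ _
  fn_smul f h p hp hp' := x.fn_smul _ h p _ _

/-- The contracted product `H' ×^H P` as a presheaf. -/
def indPresheaf (φ : ActionHom A B) (Q : QuotObj A) : Cᵒᵖ ⥤ Type (max u v) where
  obj U := IndSec φ Q U.unop
  map g := TypeCat.ofHom (IndSec.restrict g.unop)
  map_id U := by
    ext x
    exact IndSec.ext' (Category.id_comp _)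
      fun f p hp hp' => IndSec.fn_congr rfl (Category.comp_id _) rfl _ _
  map_comp g g' := by
    ext x
    exact IndSec.ext' (Category.assoc _ _ _)
      fun f p hp hp' => IndSec.fn_congr rfl (Category.assoc _ _ _).symm rfl _ _

theorem res_indPresheaf {U V : C} (g : V ⟶ U) (x : (indPresheaf φ Q).obj (op U)) :
    res (indPresheaf φ Q) g x = IndSec.restrict g x := rfl

/-- `H'` acts on `H' ×^H P` by left multiplication on the first factor. -/
instance indMulAction (U : C) : MulAction (B.H.obj (op U)) ((indPresheaf φ Q).obj (op U)) where
  smul h x :=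
    { pt := x.pt
      fn := fun f p hp => res B.H f h * x.fn f p hp
      fn_res := fun g f p hp hp' => by rw [x.fn_res g f p hp hp', B.res_mul, res_comp]
      fn_smul := fun f k p hp hp' => by rw [x.fn_smul f k p hp hp', mul_assoc] }
  one_smul x := IndSec.ext' rfl fun f p hp hp' => by
    change res B.H f 1 * x.fn f p hp = x.fn f p hp'
    rw [B.res_one, one_mul]
  mul_smul h k x := IndSec.ext' rfl fun f p hp hp' => by
    change res B.H f (h * k) * x.fn f p hp = res B.H f h * (res B.H f k * x.fn f p hp')
    rw [B.res_mul, mul_assoc]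

theorem smul_fn {U : C} (h : B.H.obj (op U)) (x : IndSec φ Q U) {V : C} (f : V ⟶ U)
    (p : Q.P.obj (op V)) (hp : Q.proj p = f ≫ x.pt) :
    IndSec.fn (h • (show (indPresheaf φ Q).obj (op U) from x) : IndSec φ Q U) f p hp =
      res B.H f h * x.fn f p hp := rfl

theorem isSheaf_indPresheaf [J.Subcanonical] (φ : ActionHom A B) (Q : QuotObj A) :
    Presieve.IsSheaf J (indPresheaf φ Q) := by
  intro U S hS x hx
  -- glue the points of the base
  have hbase : Presieve.IsSheaf J (yoneda.obj Q.base) :=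
    GrothendieckTopology.Subcanonical.isSheaf_of_isRepresentable _
  let xb : Presieve.FamilyOfElements (yoneda.obj Q.base) S.arrows :=
    fun V f hf => (x f hf : IndSec φ Q V).pt
  have hxb : xb.Compatible := fun Y₁ Y₂ Z g₁ g₂ f₁ f₂ h₁ h₂ e =>
    congrArg (fun z : IndSec φ Q Z => z.pt) (hx g₁ g₂ h₁ h₂ e)
  obtain ⟨t, ht, htu⟩ := hbase S hS xb hxb
  have ht' : ∀ {V : C} (f : V ⟶ U) (hf : S f), (x f hf : IndSec φ Q V).pt = f ≫ t :=
    fun f hf => (ht f hf).symm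
  have key : ∀ (V : C) (f : V ⟶ U) (p : Q.P.obj (op V)), Q.proj p = f ≫ t →
      ∃! y : B.H.obj (op V), ∀ {W : C} (g : W ⟶ V) (hg : S (g ≫ f))
        (hp' : Q.proj (res Q.P g p) = 𝟙 W ≫ (x (g ≫ f) hg : IndSec φ Q W).pt),
        res B.H g y = (x (g ≫ f) hg : IndSec φ Q W).fn (𝟙 W) (res Q.P g p) hp' := by
    intro V f p hp
    have hpr : ∀ {W : C} (g : W ⟶ V) (hg : S (g ≫ f)),
        Q.proj (res Q.P g p) = 𝟙 W ≫ (x (g ≫ f) hg : IndSec φ Q W).pt := fun g hg => by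
      rw [Q.proj_res, hp, ht', Category.id_comp, Category.assoc]
    let z : Presieve.FamilyOfElements B.H (S.pullback f).arrows :=
      fun W g hg => (x (g ≫ f) hg : IndSec φ Q W).fn (𝟙 W) (res Q.P g p) (hpr g hg)
    have hz : z.Compatible := by
      intro Y₁ Y₂ Z g₁ g₂ f₁ f₂ h₁ h₂ e
      have aux : ∀ {Y : C} (g : Z ⟶ Y) (f₁ : Y ⟶ V) (h₁ : S (f₁ ≫ f)) (h : S ((g ≫ f₁) ≫ f)),
          res B.H g ((x (f₁ ≫ f) h₁ : IndSec φ Q Y).fn (𝟙 Y) (res Q.P f₁ p) (hpr f₁ h₁)) =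
          (x ((g ≫ f₁) ≫ f) h : IndSec φ Q Z).fn (𝟙 Z) (res Q.P (g ≫ f₁) p) (hpr _ h) := by
        intro Y g f₁ h₁ h
        have hp₁ : Q.proj (res Q.P g (res Q.P f₁ p)) =
            (g ≫ 𝟙 Y) ≫ (x (f₁ ≫ f) h₁ : IndSec φ Q Y).pt := by
          rw [Q.proj_res, hpr f₁ h₁, Category.assoc]
        rw [← (x (f₁ ≫ f) h₁ : IndSec φ Q Y).fn_res g (𝟙 Y) _ _ hp₁]
        have hc : IndSec.restrict g (x (f₁ ≫ f) h₁ : IndSec φ Q Y) = x ((g ≫ f₁) ≫ f) h := by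
          have := hx g (𝟙 Z) h₁ h (by simp)
          refine this.trans ?_
          exact res_id (indPresheaf φ Q) _
        refine Eq.trans ?_ (IndSec.fn_congr hc rfl (res_comp Q.P g f₁ p).symm
          (by rw [hp₁]; simp [IndSec.restrict]) _)
        exact IndSec.fn_congr rfl (by simp) rfl _ _
      have h12 : S ((g₁ ≫ f₁) ≫ f) := by
        rw [Category.assoc]; exact S.downward_closed h₁ g₁
      have h12' : S ((g₂ ≫ f₂) ≫ f) := by
        rw [Category.assoc]; exact S.downward_closed h₂ g₂
      refine (aux g₁ f₁ h₁ h12).trans (Eq.trans ?_ (aux g₂ f₂ h₂ h12').symm)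
      have gen : ∀ (a b : Z ⟶ V) (ha : S (a ≫ f)) (hb : S (b ≫ f)), a = b →
          (x (a ≫ f) ha : IndSec φ Q Z).fn (𝟙 Z) (res Q.P a p) (hpr _ ha) =
          (x (b ≫ f) hb : IndSec φ Q Z).fn (𝟙 Z) (res Q.P b p) (hpr _ hb) := by
        intro a b ha hb hab
        subst hab
        rfl
      exact gen _ _ _ _ e
    obtain ⟨y, hy, hyu⟩ := B.isSheaf_H _ (J.pullback_stable f hS) z hz
    exact ⟨y, fun g hg hp' => hy g hg, fun y' hy' => hyu y' fun W g hg => hy' g hg (hpr g hg)⟩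
  choose s hs hsu using key
  have sep : ∀ {V : C} (f : V ⟶ U) (a b : B.H.obj (op V)),
      (∀ {W : C} (g : W ⟶ V), S (g ≫ f) → res B.H g a = res B.H g b) → a = b := fun f a b h =>
    (B.isSheaf_H.isSeparated _ (J.pullback_stable f hS)).ext fun W g hg => h g hg
  have hpr : ∀ {V W : C} (g : W ⟶ V) (f : V ⟶ U) (p : Q.P.obj (op V)) (hg : S (g ≫ f)),
      Q.proj p = f ≫ t →
        Q.proj (res Q.P g p) = 𝟙 W ≫ (x (g ≫ f) hg : IndSec φ Q W).pt := fun g f p hg hp => by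
    rw [Q.proj_res, hp, ht', Category.id_comp, Category.assoc]
  let y : IndSec φ Q U :=
    { pt := t
      fn := fun f p hp => s _ f p hp
      fn_res := by
        intro V W g f p hp hp'
        refine sep (g ≫ f) _ _ fun {W'} g' hg' => ?_
        have hg'' : S ((g' ≫ g) ≫ f) := by rwa [Category.assoc]
        rw [← res_comp, hs _ (g ≫ f) _ hp' g' hg' (hpr _ _ _ _ hp'),
          hs _ f p hp (g' ≫ g) hg'' (hpr _ _ _ _ hp)]
        have gen : ∀ (a b : W' ⟶ U) (ha : S a) (hb : S b) (_ : a = b) (q r : Q.P.obj (op W'))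
            (_ : q = r) (hq : Q.proj q = 𝟙 W' ≫ (x a ha : IndSec φ Q W').pt)
            (hr : Q.proj r = 𝟙 W' ≫ (x b hb : IndSec φ Q W').pt),
            (x a ha : IndSec φ Q W').fn (𝟙 W') q hq = (x b hb : IndSec φ Q W').fn (𝟙 W') r hr := by
          intro a b ha hb hab q r hqr hq hr
          subst hab hqr
          rfl
        exact gen _ _ _ _ (Category.assoc _ _ _).symm _ _ (res_comp _ _ _ _).symm _ _
      fn_smul := by
        intro V f h p hp hp'
        refine sep f _ _ fun {W} g hg => ?_
        rw [hs _ f _ hp' g hg (hpr _ _ _ _ hp'), B.res_mul, hs _ f p hp g hg (hpr _ _ _ _ hp),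
          B.res_inv, ← φ.onGroup_res]
        have e := Q.res_smul g h p
        rw [← (x (g ≫ f) hg : IndSec φ Q W).fn_smul (𝟙 W) (res A.H g h) (res Q.P g p)
          (hpr _ _ _ _ hp) (by rw [← e]; exact hpr _ _ _ _ hp')]
        exact IndSec.fn_congr rfl rfl e _ _ }
  refine ⟨y, ?_, ?_⟩
  · intro V f hf
    refine IndSec.ext' (ht' f hf).symm ?_
    intro W g p hp hp'
    have hp'' : Q.proj p = (g ≫ f) ≫ t := by rw [hp', ht', Category.assoc]
    change s _ (g ≫ f) p _ = (x f hf : IndSec φ Q V).fn g p hp'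
    refine sep (g ≫ f) _ _ fun {W'} g' hg' => ?_
    rw [hs _ (g ≫ f) p hp'' g' hg' (hpr _ _ _ _ hp''),
      ← (x f hf : IndSec φ Q V).fn_res g' g p hp'
        (by rw [Q.proj_res, hp', Category.assoc])]
    have hc : IndSec.restrict (g' ≫ g) (x f hf : IndSec φ Q V) = x (g' ≫ g ≫ f) hg' := by
      refine (hx (g' ≫ g) (𝟙 _) hf hg' (by simp)).trans ?_
      exact res_id (indPresheaf φ Q) _
    refine (IndSec.fn_congr hc.symm rfl rfl _
      (by rw [Q.proj_res, hp']; simp [IndSec.restrict])).trans ?_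
    exact IndSec.fn_congr rfl (Category.id_comp _) rfl _ _
  · intro y' hy'
    have hpt : (y' : IndSec φ Q U).pt = t :=
      htu _ fun V f hf => congrArg (fun z : IndSec φ Q V => z.pt) (hy' f hf)
    refine IndSec.ext' hpt ?_
    intro V f p hp hp'
    refine hsu _ f p hp' _ ?_
    intro W g hg hq
    rw [← (y' : IndSec φ Q U).fn_res g f p hp (by rw [Q.proj_res, hp, Category.assoc])]
    refine Eq.trans ?_ (IndSec.fn_congr (hy' (g ≫ f) hg) rfl rfl
      (by
        change _ = 𝟙 W ≫ (g ≫ f) ≫ (y' : IndSec φ Q U).pt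
        rw [Q.proj_res, hp, Category.id_comp, Category.assoc]) _)
    exact IndSec.fn_congr rfl (Category.id_comp _).symm rfl _ _

/-- The element `h` of the group with `h • p = q`. -/
noncomputable def QuotObj.div (Q : QuotObj A) {U : C} (q p : Q.P.obj (op U))
    (h : Q.proj p = Q.proj q) : A.H.obj (op U) :=
  (Q.simplyTransitive p q h).choose

theorem QuotObj.div_smul (Q : QuotObj A) {U : C} (q p : Q.P.obj (op U))
    (h : Q.proj p = Q.proj q) : Q.div q p h • p = q :=
  (Q.simplyTransitive p q h).choose_spec.1

theorem QuotObj.eq_div (Q : QuotObj A) {U : C} (q p : Q.P.obj (op U))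
    (h : Q.proj p = Q.proj q) {g : A.H.obj (op U)} (hg : g • p = q) : g = Q.div q p h :=
  (Q.simplyTransitive p q h).choose_spec.2 g hg

/-- The section `[1, p]` of the contracted product. -/
noncomputable def IndSec.ofPoint (φ : ActionHom A B) (Q : QuotObj A) {U : C} (p : Q.P.obj (op U)) :
    IndSec φ Q U where
  pt := Q.proj p
  fn f q hq := (φ.onGroup _ (Q.div q (res Q.P f p) ((Q.proj_res f p).trans hq.symm)))⁻¹
  fn_res g f q hq hq' := by
    rw [B.res_inv, ← φ.onGroup_res]
    congr 2
    refine (Q.eq_div _ _ _ ?_).symm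
    rw [res_comp, ← Q.res_smul, Q.div_smul]
  fn_smul f h q hq hq' := by
    rw [← mul_inv_rev, ← map_mul]
    congr 2
    refine (Q.eq_div _ _ _ ?_).symm
    rw [mul_smul, Q.div_smul]

theorem IndSec.fn_ofPoint {U V : C} (p : Q.P.obj (op U)) (f : V ⟶ U) (q : Q.P.obj (op V))
    (hq : Q.proj q = f ≫ Q.proj p) (h : A.H.obj (op V)) (hh : h • res Q.P f p = q) :
    (IndSec.ofPoint φ Q p).fn f q hq = (φ.onGroup _ h)⁻¹ := by
  rw [Q.eq_div q (res Q.P f p) ((Q.proj_res f p).trans hq.symm) hh]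
  rfl

/-- The value `s(p) • a(p)`, for any local section `p`, of an equivariant map `a` from the torsor to
a sheaf on which `H'` acts. -/
theorem IndSec.existsUnique_value {U' : C} (x : IndSec φ Q U') {F : Cᵒᵖ ⥤ Type w}
    [∀ U : C, MulAction (B.H.obj (op U)) (F.obj (op U))]
    (F_smul : ∀ {U V : C} (f : V ⟶ U) (h : B.H.obj (op U)) (z : F.obj (op U)),
      res F f (h • z) = res B.H f h • res F f z)
    (hF : Presieve.IsSheaf J F)
    (a : ∀ {U : C}, Q.P.obj (op U) → F.obj (op U))
    (a_res : ∀ {U V : C} (f : V ⟶ U) (p : Q.P.obj (op U)), a (res Q.P f p) = res F f (a p))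
    (a_smul : ∀ {U : C} (h : A.H.obj (op U)) (p : Q.P.obj (op U)),
      a (h • p) = φ.onGroup U h • a p) :
    ∃! y : F.obj (op U'), ∀ {V : C} (f : V ⟶ U') (p : Q.P.obj (op V)) (hp : Q.proj p = f ≫ x.pt),
      res F f y = x.fn f p hp • a p := by
  refine Q.descend hF x.pt (fun f p hp => x.fn f p hp • a p) ?_ ?_
  · intro V W g f p hp hp'
    rw [x.fn_res g f p hp hp', a_res, F_smul]
  · intro V f h p hp hp'
    rw [x.fn_smul f h p hp hp', a_smul, smul_smul, inv_mul_cancel_right]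

theorem IndSec.existsUnique_toSpace {U : C} (x : IndSec φ Q U) :
    ∃! y : B.Z.obj (op U), ∀ {V : C} (f : V ⟶ U) (p : Q.P.obj (op V)) (hp : Q.proj p = f ≫ x.pt),
      res B.Z f y = x.fn f p hp • φ.onSpace V (Q.toSpace p) :=
  x.existsUnique_value (fun f => B.res_smul f) B.isSheaf_Z
    (fun {U} p => φ.onSpace U (Q.toSpace p))
    (fun f p => by rw [Q.toSpace_res, φ.onSpace_res])
    (fun h p => by rw [Q.toSpace_smul, φ.onSpace_smul])

/-- The map `H' ×^H P → Z'`, `[h', p] ↦ h' • ψ(z(p))`, where `z : P → Z` and `ψ : Z → Z'` are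
the given maps. -/
noncomputable def IndSec.toSpace {U : C} (x : IndSec φ Q U) : B.Z.obj (op U) :=
  x.existsUnique_toSpace.choose

theorem IndSec.res_toSpace {U V : C} (x : IndSec φ Q U) (f : V ⟶ U) (p : Q.P.obj (op V))
    (hp : Q.proj p = f ≫ x.pt) :
    res B.Z f x.toSpace = x.fn f p hp • φ.onSpace V (Q.toSpace p) :=
  x.existsUnique_toSpace.choose_spec.1 f p hp

theorem IndSec.eq_toSpace {U : C} (x : IndSec φ Q U) (y : B.Z.obj (op U))
    (hy : ∀ {V : C} (f : V ⟶ U) (p : Q.P.obj (op V)) (hp : Q.proj p = f ≫ x.pt),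
      res B.Z f y = x.fn f p hp • φ.onSpace V (Q.toSpace p)) : y = x.toSpace :=
  x.existsUnique_toSpace.choose_spec.2 y hy

variable [J.Subcanonical]

/-- The contracted product `H' ×^H P` as an object of `[Z'/H']`. -/
noncomputable def indObj (φ : ActionHom A B) (Q : QuotObj A) : QuotObj B where
  base := Q.base
  P := indPresheaf φ Q
  isSheaf := isSheaf_indPresheaf φ Q
  mulAction := indMulAction
  res_smul {U V} f h x := IndSec.ext' rfl fun {W} g p hp hp' => by
    change res B.H (g ≫ f) h * IndSec.fn x (g ≫ f) p _ =
      res B.H g (res B.H f h) * IndSec.fn x (g ≫ f) p _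
    rw [res_comp]
  proj x := IndSec.pt x
  proj_res _ _ := rfl
  proj_smul _ _ := rfl
  simplyTransitive {U} x y hxy := by
    obtain ⟨h, hh, hu⟩ := Q.descend B.isSheaf_H (IndSec.pt x)
      (fun f p hp => IndSec.fn y f p (hp.trans (congrArg (f ≫ ·) hxy)) * (IndSec.fn x f p hp)⁻¹)
      (fun g f p hp hp' => by
        rw [IndSec.fn_res x g f p hp hp',
          IndSec.fn_res y g f p (hp.trans (congrArg (f ≫ ·) hxy)), B.res_mul, B.res_inv])
      (fun f h p hp hp' => by
        rw [IndSec.fn_smul x f h p hp hp',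
          IndSec.fn_smul y f h p (hp.trans (congrArg (f ≫ ·) hxy))]
        group)
    refine ⟨h, ?_, ?_⟩
    · refine IndSec.ext' hxy fun {V} f p hp hp' => ?_
      refine (smul_fn h x f p hp).trans ?_
      rw [hh f p hp, inv_mul_cancel_right]
    · rintro h' rfl
      refine hu h' fun {V} f p hp => ?_
      rw [smul_fn h' x f p hp, mul_inv_cancel_right]
  locallyNonempty {U} t := by
    obtain ⟨S, hS, hne⟩ := Q.locallyNonempty t
    refine ⟨S, hS, fun V f hf => ?_⟩
    obtain ⟨p, hp⟩ := hne f hf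
    exact ⟨IndSec.ofPoint φ Q p, hp⟩
  toSpace x := IndSec.toSpace x
  toSpace_res {U V} f x := by
    refine (IndSec.eq_toSpace (IndSec.restrict f x) _ fun {W} g p hp => ?_).symm
    rw [← res_comp]
    exact IndSec.res_toSpace x (g ≫ f) p _
  toSpace_smul {U} h x := by
    refine (IndSec.eq_toSpace (h • x) _ fun {W} g p hp => ?_).symm
    rw [B.res_smul, IndSec.res_toSpace x g p hp, smul_smul]
    rfl

/-- The canonical map `P → H' ×^H P`, `p ↦ [1, p]`. -/
noncomputable def toInd (φ : ActionHom A B) (Q : QuotObj A) : TorsorMap φ Q (indObj φ Q) where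
  base := 𝟙 Q.base
  map U p := IndSec.ofPoint φ Q p
  map_res {U V} f p := by
    refine IndSec.ext' (Q.proj_res f p) fun {W} g q hq hq' => ?_
    have hq₁ : Q.proj (res Q.P g (res Q.P f p)) = Q.proj q := (Q.proj_res _ _).trans hq.symm
    have e := Q.div_smul q (res Q.P g (res Q.P f p)) hq₁
    refine (IndSec.fn_ofPoint _ g q hq _ e).trans (IndSec.fn_ofPoint p (g ≫ f) q
      (hq'.trans (Category.assoc _ _ _).symm) _ ?_).symm
    rw [res_comp, e]
  map_smul {U} h p := by
    refine IndSec.ext' (Q.proj_smul h p) fun {W} g q hq hq' => ?_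
    have hq₁ : Q.proj (res Q.P g (h • p)) = Q.proj q := (Q.proj_res _ _).trans hq.symm
    have e := Q.div_smul q (res Q.P g (h • p)) hq₁
    refine (IndSec.fn_ofPoint (h • p) g q hq _ e).trans ?_
    refine Eq.trans ?_ (smul_fn (φ.onGroup U h) (IndSec.ofPoint φ Q p) g q hq').symm
    rw [IndSec.fn_ofPoint p g q hq' (Q.div q (res Q.P g (h • p)) hq₁ * res A.H g h)
      (by rw [mul_smul, ← Q.res_smul, e]), map_mul, mul_inv_rev, φ.onGroup_res,
      mul_inv_cancel_left]
  proj_map p := (Category.comp_id _).symm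
  toSpace_map {U} p := by
    refine (IndSec.eq_toSpace (IndSec.ofPoint φ Q p) _ fun {V} f q hq => ?_).symm
    have hq₁ : Q.proj (res Q.P f p) = Q.proj q := by rw [Q.proj_res]; exact hq.symm
    have e := Q.div_smul q (res Q.P f p) hq₁
    rw [IndSec.fn_ofPoint p f q hq _ e, ← φ.onSpace_res, ← Q.toSpace_res, eq_inv_smul_iff,
      ← φ.onSpace_smul, ← Q.toSpace_smul, e]

/-- Every section of `H' ×^H P` is locally of the form `[h', p] = h' • [1, p]`. -/
theorem res_indSec {U V : C} (x : IndSec φ Q U) (f : V ⟶ U) (p : Q.P.obj (op V))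
    (hp : Q.proj p = f ≫ x.pt) :
    res (indObj φ Q).P f x = x.fn f p hp • (toInd φ Q).map V p := by
  refine IndSec.ext' hp.symm fun {W} g q hq hq' => ?_
  have hq₁ : Q.proj (res Q.P g p) = Q.proj q := by rw [Q.proj_res]; exact hq'.symm
  have e := Q.div_smul q (res Q.P g p) hq₁
  refine Eq.trans ?_ (smul_fn _ (IndSec.ofPoint φ Q p) g q hq').symm
  have hp₁ : Q.proj (res Q.P g p) = (g ≫ f) ≫ x.pt := by rw [Q.proj_res, hp, Category.assoc]
  rw [IndSec.fn_ofPoint p g q hq' _ e, ← x.fn_res g f p hp hp₁]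
  have hp₂ : Q.proj (Q.div q (res Q.P g p) hq₁ • res Q.P g p) = (g ≫ f) ≫ x.pt := by
    rw [Q.proj_smul]; exact hp₁
  exact (IndSec.fn_congr rfl rfl e.symm (by rw [← e]; exact hp₂) hp₂).trans
    (x.fn_smul (g ≫ f) _ _ hp₁ hp₂)

/-- Morphisms out of the contracted product are determined by their composite with
`P → H' ×^H P`. -/
theorem indObj_hom_ext {R : QuotObj B} {a b : indObj φ Q ⟶ R} (hb : a.base = b.base)
    (h : ∀ (U : C) (p : Q.P.obj (op U)),
      a.map U ((toInd φ Q).map U p) = b.map U ((toInd φ Q).map U p)) : a = b := by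
  refine QuotObj.hom_ext hb fun U x => ?_
  obtain ⟨S, hS, hne⟩ := Q.locallyNonempty (IndSec.pt x)
  refine (R.isSheaf.isSeparated S hS).ext fun V f hf => ?_
  obtain ⟨p, hp⟩ := hne f hf
  change res R.P f (a.map U x) = res R.P f (b.map U x)
  rw [← a.map_res, ← b.map_res, res_indSec x f p hp, a.map_smul, b.map_smul, h]

/-- A map of torsors along `φ` factors through the contracted product. -/
theorem TorsorMap.exists_lift {R : QuotObj B} (a : TorsorMap φ Q R) :
    ∃ b : indObj φ Q ⟶ R, b.base = a.base ∧
      ∀ (U : C) (p : Q.P.obj (op U)), b.map U ((toInd φ Q).map U p) = a.map U p := by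
  have key : ∀ (U : C) (x : IndSec φ Q U), ∃! y : R.P.obj (op U), ∀ {V : C} (f : V ⟶ U)
      (p : Q.P.obj (op V)) (hp : Q.proj p = f ≫ x.pt),
      res R.P f y = x.fn f p hp • a.map V p := fun U x =>
    x.existsUnique_value (fun f => R.res_smul f) R.isSheaf (fun {U} p => a.map U p)
      (fun f p => a.map_res f p) (fun h p => a.map_smul h p)
  choose m hm hmu using key
  have map_of : ∀ (U : C) (p : Q.P.obj (op U)), m U (IndSec.ofPoint φ Q p) = a.map U p := by
    intro U p
    refine (hmu U _ _ fun {V} f q hq => ?_).symm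
    have hq₁ : Q.proj (res Q.P f p) = Q.proj q := by rw [Q.proj_res]; exact hq.symm
    have e := Q.div_smul q (res Q.P f p) hq₁
    rw [IndSec.fn_ofPoint p f q hq _ e, ← a.map_res, eq_inv_smul_iff, ← a.map_smul, e]
  refine ⟨QuotHom.mk a.base m ?_ ?_ ?_ ?_, rfl, map_of⟩
  · intro U V f x
    refine (hmu V (IndSec.restrict f x) _ fun {W} g p hp => ?_).symm
    rw [← res_comp]
    exact hm U x (g ≫ f) p _
  · intro U h x
    refine (hmu U (h • (show (indPresheaf φ Q).obj (op U) from x)) _ fun {W} g p hp => ?_).symm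
    rw [R.res_smul, hm U x g p hp, smul_smul]
    rfl
  · intro U x
    have hbase : Presieve.IsSheaf J (yoneda.obj R.base) :=
      GrothendieckTopology.Subcanonical.isSheaf_of_isRepresentable _
    obtain ⟨S, hS, hne⟩ := Q.locallyNonempty (IndSec.pt x)
    refine (hbase.isSeparated S hS).ext fun V f hf => ?_
    obtain ⟨p, hp⟩ := hne f hf
    change f ≫ R.proj (m U x) = f ≫ IndSec.pt x ≫ a.base
    rw [← R.proj_res, hm U x f p hp, R.proj_smul, a.proj_map, hp, Category.assoc]
  · intro U x
    refine IndSec.eq_toSpace x _ fun {V} f p hp => ?_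
    rw [← R.toSpace_res, hm U x f p hp, R.toSpace_smul, a.toSpace_map]

/-- Composition of a morphism of torsors with a map of torsors along `φ`. -/
def TorsorMap.precomp {Q Q' : QuotObj A} {R : QuotObj B} (a : Q ⟶ Q') (b : TorsorMap φ Q' R) :
    TorsorMap φ Q R where
  base := a.base ≫ b.base
  map U p := b.map U (a.map U p)
  map_res f p := by rw [a.map_res, b.map_res]
  map_smul h p := by rw [a.map_smul, b.map_smul]
  proj_map p := by rw [b.proj_map, a.proj_map, Category.assoc]
  toSpace_map p := by rw [b.toSpace_map, a.toSpace_map]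

/-- The morphism `H' ×^H P → H' ×^H P'` induced by `a : P → P'`, `[h', p] ↦ [h', a(p)]`. -/
noncomputable def indMap (φ : ActionHom A B) {Q Q' : QuotObj A} (a : Q ⟶ Q') :
    indObj φ Q ⟶ indObj φ Q' :=
  (TorsorMap.precomp a (toInd φ Q')).exists_lift.choose

theorem indMap_base (φ : ActionHom A B) {Q Q' : QuotObj A} (a : Q ⟶ Q') :
    (indMap φ a).base = a.base :=
  (TorsorMap.precomp a (toInd φ Q')).exists_lift.choose_spec.1.trans (Category.comp_id _)

theorem indMap_toInd (φ : ActionHom A B) {Q Q' : QuotObj A} (a : Q ⟶ Q') (U : C)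
    (p : Q.P.obj (op U)) :
    (indMap φ a).map U ((toInd φ Q).map U p) = (toInd φ Q').map U (a.map U p) :=
  (TorsorMap.precomp a (toInd φ Q')).exists_lift.choose_spec.2 U p

/-- The morphism of quotient stacks `[Z/H] ⟶ [Z'/H']` induced by a morphism of group actions,
`(P → Z) ↦ (H' ×^H P → Z')`. -/
noncomputable def inducedMap (φ : ActionHom A B) : quotientStack A ⟶ quotientStack B :=
  BasedFunctor.mk (𝒳 := quotientStack A) (𝒴 := quotientStack B)
    { obj := fun Q => indObj φ Q
      map := fun a => indMap φ a
      map_id := fun Q => indObj_hom_ext (indMap_base φ _) fun U p => indMap_toInd φ (𝟙 Q) U p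
      map_comp := fun {Q Q' Q''} a b => indObj_hom_ext
        ((indMap_base φ _).trans
          (congrArg₂ (· ≫ ·) (indMap_base φ a) (indMap_base φ b)).symm) fun U p => by
        refine (indMap_toInd φ (a ≫ b) U p).trans ?_
        refine Eq.trans ?_ (congrArg ((indMap φ b).map U) (indMap_toInd φ a U p)).symm
        exact (indMap_toInd φ b U (a.map U p)).symm }
    (CategoryTheory.Functor.ext (fun _ => rfl) (fun Q Q' a => by
      refine (indMap_base φ a).trans ?_
      change a.base = 𝟙 _ ≫ a.base ≫ 𝟙 _
      rw [Category.comp_id, Category.id_comp]))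

end Induced

/-! ## 2-fibre products of categories over `C` -/

/-- An object `(x, y, ι)` of the 2-fibre product `𝒳 ×_𝒵 𝒴`: objects `x`, `y` over the same object
of the base and an isomorphism `ι : F x ≅ G y` over its identity. -/
structure FiberProductObj {𝒳 𝒴 𝒵 : BasedCategory.{w, u'} C} (F : 𝒳 ⟶ 𝒵) (G : 𝒴 ⟶ 𝒵) where
  fst : 𝒳.obj
  snd : 𝒴.obj
  iso : F.obj fst ≅ G.obj snd
  isHomLift : 𝒵.p.IsHomLift (𝟙 (𝒳.p.obj fst)) iso.hom

/-- A morphism of the 2-fibre product: a pair of morphisms over the same morphism of the base that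
is compatible with the given isomorphisms. -/
@[ext]
structure FiberProductHom {𝒳 𝒴 𝒵 : BasedCategory.{w, u'} C} {F : 𝒳 ⟶ 𝒵} {G : 𝒴 ⟶ 𝒵}
    (c d : FiberProductObj F G) where
  fst : c.fst ⟶ d.fst
  snd : c.snd ⟶ d.snd
  isHomLift : 𝒴.p.IsHomLift (𝒳.p.map fst) snd
  w : F.map fst ≫ d.iso.hom = c.iso.hom ≫ G.map snd

theorem FiberProductObj.p_snd {𝒳 𝒴 𝒵 : BasedCategory.{w, u'} C} {F : 𝒳 ⟶ 𝒵} {G : 𝒴 ⟶ 𝒵}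
    (c : FiberProductObj F G) : 𝒴.p.obj c.snd = 𝒳.p.obj c.fst := by
  have := c.isHomLift
  rw [← BasedFunctor.w_obj G c.snd]
  exact IsHomLift.codomain_eq 𝒵.p (𝟙 (𝒳.p.obj c.fst)) c.iso.hom

instance {𝒳 𝒴 𝒵 : BasedCategory.{w, u'} C} (F : 𝒳 ⟶ 𝒵) (G : 𝒴 ⟶ 𝒵) :
    Category (FiberProductObj F G) where
  Hom := FiberProductHom
  id c :=
    { fst := 𝟙 _
      snd := 𝟙 _
      isHomLift := by
        rw [CategoryTheory.Functor.map_id]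
        exact IsHomLift.id c.p_snd
      w := by simp }
  comp {c d e} a b :=
    { fst := a.fst ≫ b.fst
      snd := a.snd ≫ b.snd
      isHomLift := by
        have := a.isHomLift
        have := b.isHomLift
        rw [CategoryTheory.Functor.map_comp]
        infer_instance
      w := by
        rw [CategoryTheory.Functor.map_comp, CategoryTheory.Functor.map_comp,
          Category.assoc, b.w, reassoc_of% a.w] }
  id_comp a := FiberProductHom.ext (Category.id_comp _) (Category.id_comp _)
  comp_id a := FiberProductHom.ext (Category.comp_id _) (Category.comp_id _)
  assoc a b c := FiberProductHom.ext (Category.assoc _ _ _) (Category.assoc _ _ _)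

/-- The 2-fibre product `𝒳 ×_𝒵 𝒴` of categories over `C`. -/
def fiberProduct {𝒳 𝒴 𝒵 : BasedCategory.{w, max w u'} C} (F : 𝒳 ⟶ 𝒵) (G : 𝒴 ⟶ 𝒵) :
    BasedCategory.{w, max w u'} C :=
  BasedCategory.ofFunctor (𝒳 := FiberProductObj F G)
    { obj := fun c => 𝒳.p.obj c.fst
      map := fun a => 𝒳.p.map a.fst
      map_id := fun c => 𝒳.p.map_id c.fst
      map_comp := fun a b => 𝒳.p.map_comp a.fst b.fst }

/-- The projection of the 2-fibre product to the first factor. -/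
def fiberProductFst {𝒳 𝒴 𝒵 : BasedCategory.{w, max w u'} C} (F : 𝒳 ⟶ 𝒵) (G : 𝒴 ⟶ 𝒵) :
    fiberProduct F G ⟶ 𝒳 :=
  BasedFunctor.mk (𝒳 := fiberProduct F G) (𝒴 := 𝒳)
    { obj := fun c => FiberProductObj.fst c
      map := fun a => FiberProductHom.fst a
      map_id := fun _ => rfl
      map_comp := fun _ _ => rfl }
    rfl

/-- The projection of the 2-fibre product to the second factor. -/
def fiberProductSnd {𝒳 𝒴 𝒵 : BasedCategory.{w, max w u'} C} (F : 𝒳 ⟶ 𝒵) (G : 𝒴 ⟶ 𝒵) :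
    fiberProduct F G ⟶ 𝒴 :=
  BasedFunctor.mk (𝒳 := fiberProduct F G) (𝒴 := 𝒴)
    { obj := fun c => FiberProductObj.snd c
      map := fun a => FiberProductHom.snd a
      map_id := fun _ => rfl
      map_comp := fun _ _ => rfl }
    (CategoryTheory.Functor.ext (fun c => FiberProductObj.p_snd c) fun c d a => by
      have := FiberProductHom.isHomLift a
      exact IsHomLift.fac' 𝒴.p (𝒳.p.map (FiberProductHom.fst a)) (FiberProductHom.snd a))

end Site

/-! ## Twisted conjugation quotients of algebraic groups -/

section Groups

open MonObj

variable {k : Type u} [Field k]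

/-- The fpqc topology on the category of schemes over `k`. -/
noncomputable abbrev fpqc (k : Type u) [Field k] : GrothendieckTopology (Over (Spec (.of k))) :=
  Scheme.fpqcTopology.over (Spec (.of k))

/-- A universal homeomorphism of schemes. -/
def IsUniversalHomeomorphism {X Y : Scheme.{u}} (f : X ⟶ Y) : Prop :=
  MorphismProperty.universally (topologically @IsHomeomorph) f

/-- The presheaf `U ↦ X(U) × Y(U)`. -/
def prodPresheaf {C : Type u} [Category.{v} C] (X Y : C) : Cᵒᵖ ⥤ Type v where
  obj U := (U.unop ⟶ X) × (U.unop ⟶ Y)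
  map f := TypeCat.ofHom fun x => (f.unop ≫ x.1, f.unop ≫ x.2)

theorem isSheaf_prodPresheaf {C : Type u} [Category.{v} C] (J : GrothendieckTopology C)
    [J.Subcanonical] (X Y : C) : Presieve.IsSheaf J (prodPresheaf X Y) := by
  have h : ∀ T : C, Presieve.IsSheaf J (yoneda.obj T) := fun T =>
    GrothendieckTopology.Subcanonical.isSheaf_of_isRepresentable _
  intro U S hS x hx
  obtain ⟨a, ha, hau⟩ := h X S hS (fun V f hf => (x f hf).1)
    fun Y₁ Y₂ Z g₁ g₂ f₁ f₂ h₁ h₂ e => congrArg Prod.fst (hx g₁ g₂ h₁ h₂ e)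
  obtain ⟨b, hb, hbu⟩ := h Y S hS (fun V f hf => (x f hf).2)
    fun Y₁ Y₂ Z g₁ g₂ f₁ f₂ h₁ h₂ e => congrArg Prod.snd (hx g₁ g₂ h₁ h₂ e)
  refine ⟨(a, b), fun V f hf => Prod.ext (ha f hf) (hb f hf), fun y hy => ?_⟩
  exact Prod.ext (hau _ fun V f hf => congrArg Prod.fst (hy f hf))
    (hbu _ fun V f hf => congrArg Prod.snd (hy f hf))

theorem res_yoneda {C : Type u} [Category.{v} C] (X : C) {U V : C} (f : V ⟶ U) (x : U ⟶ X) :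
    res (yoneda.obj X) f x = f ≫ x := rfl

theorem res_prodPresheaf {C : Type u} [Category.{v} C] (X Y : C) {U V : C} (f : V ⟶ U)
    (x : (U ⟶ X) × (U ⟶ Y)) :
    res (prodPresheaf X Y) f x = ((f ≫ x.1, f ≫ x.2) : (V ⟶ X) × (V ⟶ Y)) := rfl

noncomputable instance pointsGroup (K : Over (Spec (.of k))) [GrpObj K] (U : Over (Spec (.of k))) :
    Group ((yoneda.obj K).obj (op U)) :=
  inferInstanceAs (Group (U ⟶ K))

noncomputable instance prodPointsGroup (K L : Over (Spec (.of k))) [GrpObj K] [GrpObj L]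
    (U : Over (Spec (.of k))) : Group ((prodPresheaf K L).obj (op U)) :=
  inferInstanceAs (Group ((U ⟶ K) × (U ⟶ L)))

variable {G K : Over (Spec (.of k))} [GrpObj G] [GrpObj K]

/-- The action `a • g = σ(a) g a⁻¹` of the points of `K` on the points of `G`, where `a` is viewed
in `G` through `i`. -/
noncomputable abbrev adMulAction (i : K ⟶ G) [IsMonHom i] (σ : G ⟶ G) [IsMonHom σ]
    (U : Over (Spec (.of k))) : MulAction (U ⟶ K) (U ⟶ G) where
  smul a g := (a ≫ i ≫ σ) * g * (a ≫ i)⁻¹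
  one_smul g := by
    change ((1 : U ⟶ K) ≫ i ≫ σ) * g * ((1 : U ⟶ K) ≫ i)⁻¹ = g
    simp [MonObj.one_comp]
  mul_smul a b g := by
    change ((a * b) ≫ i ≫ σ) * g * ((a * b) ≫ i)⁻¹ =
      (a ≫ i ≫ σ) * ((b ≫ i ≫ σ) * g * (b ≫ i)⁻¹) * (a ≫ i)⁻¹
    simp only [MonObj.mul_comp, mul_inv_rev, _root_.mul_assoc]

/-- The `σ`-twisted adjoint action of `K` on `G`. -/
noncomputable def adAction (i : K ⟶ G) [IsMonHom i] (σ : G ⟶ G) [IsMonHom σ] :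
    GroupAction (fpqc k) where
  H := yoneda.obj K
  Z := yoneda.obj G
  group U := pointsGroup K U
  mulAction U := adMulAction i σ U
  res_mul {U V} f a b := MonObj.comp_mul f a b
  res_smul {U V} f (a : U ⟶ K) (g : U ⟶ G) := by
    change f ≫ ((a ≫ i ≫ σ) * g * (a ≫ i)⁻¹) =
      ((f ≫ a) ≫ i ≫ σ) * (f ≫ g) * ((f ≫ a) ≫ i)⁻¹
    simp only [MonObj.comp_mul, GrpObj.comp_inv, Category.assoc]
  isSheaf_H := GrothendieckTopology.Subcanonical.isSheaf_of_isRepresentable _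
  isSheaf_Z := GrothendieckTopology.Subcanonical.isSheaf_of_isRepresentable _

/-- The action `(a₁, a₂) • (g₁, g₂) = (σ(a₁) g₁ a₂⁻¹, a₂ g₂ a₁⁻¹)` of the points of `K × K` on the
points of `G × G`. -/
noncomputable abbrev adMulAction₂ (i : K ⟶ G) [IsMonHom i] (σ : G ⟶ G) [IsMonHom σ]
    (U : Over (Spec (.of k))) : MulAction ((U ⟶ K) × (U ⟶ K)) ((U ⟶ G) × (U ⟶ G)) where
  smul a g := ((a.1 ≫ i ≫ σ) * g.1 * (a.2 ≫ i)⁻¹, (a.2 ≫ i) * g.2 * (a.1 ≫ i)⁻¹)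
  one_smul g := by
    change (((1 : U ⟶ K) ≫ i ≫ σ) * g.1 * ((1 : U ⟶ K) ≫ i)⁻¹,
      ((1 : U ⟶ K) ≫ i) * g.2 * ((1 : U ⟶ K) ≫ i)⁻¹) = g
    simp [MonObj.one_comp]
  mul_smul a b g := by
    change (((a.1 * b.1) ≫ i ≫ σ) * g.1 * ((a.2 * b.2) ≫ i)⁻¹,
        ((a.2 * b.2) ≫ i) * g.2 * ((a.1 * b.1) ≫ i)⁻¹) =
      ((a.1 ≫ i ≫ σ) * ((b.1 ≫ i ≫ σ) * g.1 * (b.2 ≫ i)⁻¹) * (a.2 ≫ i)⁻¹,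
        (a.2 ≫ i) * ((b.2 ≫ i) * g.2 * (b.1 ≫ i)⁻¹) * (a.1 ≫ i)⁻¹)
    simp only [MonObj.mul_comp, mul_inv_rev, _root_.mul_assoc]

/-- The action of `K × K` on `G × G` whose quotient is `X₂`. -/
noncomputable def adAction₂ (i : K ⟶ G) [IsMonHom i] (σ : G ⟶ G) [IsMonHom σ] :
    GroupAction (fpqc k) where
  H := prodPresheaf K K
  Z := prodPresheaf G G
  group U := prodPointsGroup K K U
  mulAction U := adMulAction₂ i σ U
  res_mul {U V} f (a : (U ⟶ K) × (U ⟶ K)) (b : (U ⟶ K) × (U ⟶ K)) :=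
    Prod.ext (MonObj.comp_mul f a.1 b.1) (MonObj.comp_mul f a.2 b.2)
  res_smul {U V} f (a : (U ⟶ K) × (U ⟶ K)) (g : (U ⟶ G) × (U ⟶ G)) := by
    change (f ≫ ((a.1 ≫ i ≫ σ) * g.1 * (a.2 ≫ i)⁻¹), f ≫ ((a.2 ≫ i) * g.2 * (a.1 ≫ i)⁻¹)) =
      (((f ≫ a.1) ≫ i ≫ σ) * (f ≫ g.1) * ((f ≫ a.2) ≫ i)⁻¹,
        ((f ≫ a.2) ≫ i) * (f ≫ g.2) * ((f ≫ a.1) ≫ i)⁻¹)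
    simp only [MonObj.comp_mul, GrpObj.comp_inv, Category.assoc]
  isSheaf_H := isSheaf_prodPresheaf _ K K
  isSheaf_Z := isSheaf_prodPresheaf _ G G

/-- `(K, G) → (G, G)`, `a ↦ a`, `g ↦ g`, for the twisted adjoint actions. -/
noncomputable def inclusionAction (i : K ⟶ G) [IsMonHom i] (σ : G ⟶ G) [IsMonHom σ] :
    ActionHom (adAction i σ) (adAction (𝟙 G) σ) where
  onGroup U := IsMonHom.monoidHom i U
  onGroup_res f (a : _ ⟶ K) := Category.assoc f a i
  onSpace U g := g
  onSpace_res _ _ := rfl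
  onSpace_smul {U} (a : U ⟶ K) (g : U ⟶ G) := by
    change (a ≫ i ≫ σ) * g * (a ≫ i)⁻¹ =
      ((a ≫ i) ≫ 𝟙 G ≫ σ) * g * ((a ≫ i) ≫ 𝟙 G)⁻¹
    simp only [Category.assoc, Category.id_comp, Category.comp_id]

/-- `(K × K, G × G) → (K, G)`, `(a₁, a₂) ↦ a₁`, `(g₁, g₂) ↦ g₁ g₂`. -/
noncomputable def multAction (i : K ⟶ G) [IsMonHom i] (σ : G ⟶ G) [IsMonHom σ] :
    ActionHom (adAction₂ i σ) (adAction i σ) where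
  onGroup U := MonoidHom.fst (U ⟶ K) (U ⟶ K)
  onGroup_res _ _ := rfl
  onSpace U (g : (U ⟶ G) × (U ⟶ G)) := g.1 * g.2
  onSpace_res f (g : (_ ⟶ G) × (_ ⟶ G)) := (MonObj.comp_mul f g.1 g.2).symm
  onSpace_smul {U} (a : (U ⟶ K) × (U ⟶ K)) (g : (U ⟶ G) × (U ⟶ G)) := by
    change ((a.1 ≫ i ≫ σ) * g.1 * (a.2 ≫ i)⁻¹) * ((a.2 ≫ i) * g.2 * (a.1 ≫ i)⁻¹) =
      (a.1 ≫ i ≫ σ) * (g.1 * g.2) * (a.1 ≫ i)⁻¹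
    group

/-- `(K × K, G × G) → (K × K, G × G)`, `(a₁, a₂) ↦ (a₂, σ(a₁))`, `(g₁, g₂) ↦ (σ(g₂), g₁)`. -/
noncomputable def partialAction (i : K ⟶ G) [IsMonHom i] (σ : G ⟶ G) [IsMonHom σ]
    (σK : K ⟶ K) [IsMonHom σK] (hσK : σK ≫ i = i ≫ σ) :
    ActionHom (adAction₂ i σ) (adAction₂ i σ) where
  onGroup U := (MonoidHom.snd (U ⟶ K) (U ⟶ K)).prod
    ((IsMonHom.monoidHom σK U).comp (MonoidHom.fst (U ⟶ K) (U ⟶ K)))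
  onGroup_res f (a : (_ ⟶ K) × (_ ⟶ K)) := Prod.ext rfl (Category.assoc f a.1 σK)
  onSpace U (g : (U ⟶ G) × (U ⟶ G)) := ((g.2 ≫ σ, g.1) : (U ⟶ G) × (U ⟶ G))
  onSpace_res f (g : (_ ⟶ G) × (_ ⟶ G)) := Prod.ext (Category.assoc f g.2 σ) rfl
  onSpace_smul {U} (a : (U ⟶ K) × (U ⟶ K)) (g : (U ⟶ G) × (U ⟶ G)) := by
    change (((a.2 ≫ i) * g.2 * (a.1 ≫ i)⁻¹) ≫ σ, (a.1 ≫ i ≫ σ) * g.1 * (a.2 ≫ i)⁻¹) =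
      ((a.2 ≫ i ≫ σ) * (g.2 ≫ σ) * ((a.1 ≫ σK) ≫ i)⁻¹,
        ((a.1 ≫ σK) ≫ i) * g.1 * (a.2 ≫ i)⁻¹)
    simp only [MonObj.mul_comp, GrpObj.inv_comp, Category.assoc, hσK]

/-- The quotient stack `G / Ad_σ K` over schemes over `k`; for `i = 𝟙 G` this is `G / Ad_σ G`. -/
noncomputable abbrev adQuotient (i : K ⟶ G) [IsMonHom i] (σ : G ⟶ G) [IsMonHom σ] :
    BasedCategory (Over (Spec (.of k))) :=
  quotientStack (adAction i σ)

/-- The quotient stack `X₂ = (G ×^K G) / Ad_σ K`, that is, the quotient of `G × G` by the action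
`(a₁, a₂) • (g₁, g₂) = (σ(a₁) g₁ a₂⁻¹, a₂ g₂ a₁⁻¹)` of `K × K`. -/
noncomputable abbrev adQuotient₂ (i : K ⟶ G) [IsMonHom i] (σ : G ⟶ G) [IsMonHom σ] :
    BasedCategory (Over (Spec (.of k))) :=
  quotientStack (adAction₂ i σ)

/-- The natural map `f : G / Ad_σ K ⟶ G / Ad_σ G`. -/
noncomputable abbrev adMap (i : K ⟶ G) [IsMonHom i] (σ : G ⟶ G) [IsMonHom σ] :
    adQuotient i σ ⟶ adQuotient (𝟙 G) σ :=
  inducedMap (inclusionAction i σ)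

/-- The multiplication map `m : X₂ ⟶ X`, induced by `(g₁, g₂) ↦ g₁ g₂`. -/
noncomputable abbrev multMap (i : K ⟶ G) [IsMonHom i] (σ : G ⟶ G) [IsMonHom σ] :
    adQuotient₂ i σ ⟶ adQuotient i σ :=
  inducedMap (multAction i σ)

/-- The partial `σ`-map `X₂ ⟶ X₂`, induced by `(g₁, g₂) ↦ (σ(g₂), g₁)`. -/
noncomputable abbrev partialMap (i : K ⟶ G) [IsMonHom i] (σ : G ⟶ G) [IsMonHom σ]
    (σK : K ⟶ K) [IsMonHom σK] (hσK : σK ≫ i = i ≫ σ) :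
    adQuotient₂ i σ ⟶ adQuotient₂ i σ :=
  inducedMap (partialAction i σ σK hσK)

/-- The second coordinate `g₂ : P → G` of the map `P → G × G` that is part of an object of `X₂`. -/
noncomputable def secondCoordinate {i : K ⟶ G} [IsMonHom i] {σ : G ⟶ G} [IsMonHom σ]
    (Q : QuotObj (adAction₂ i σ)) {U : Over (Spec (.of k))} (p : Q.P.obj (op U)) :
    (adAction (𝟙 G) σ).H.obj (op U) :=
  (show (U ⟶ G) × (U ⟶ G) from Q.toSpace p).2

/-- The 2-fibre product `X ×_Y X` along `f : X ⟶ Y`, for `X = G / Ad_σ K`, `Y = G / Ad_σ G`. -/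
noncomputable abbrev adFiberProduct (i : K ⟶ G) [IsMonHom i] (σ : G ⟶ G) [IsMonHom σ] :
    BasedCategory (Over (Spec (.of k))) :=
  fiberProduct.{u + 1, u, u + 1, u + 2} (adMap i σ) (adMap i σ)

/-- The left projection `X ×_Y X ⟶ X`. -/
noncomputable abbrev leftProjection (i : K ⟶ G) [IsMonHom i] (σ : G ⟶ G) [IsMonHom σ] :
    adFiberProduct i σ ⟶ adQuotient i σ :=
  fiberProductFst.{u + 1, u, u + 1, u + 2} (adMap i σ) (adMap i σ)

/-- The right projection `X ×_Y X ⟶ X`. -/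
noncomputable abbrev rightProjection (i : K ⟶ G) [IsMonHom i] (σ : G ⟶ G) [IsMonHom σ] :
    adFiberProduct i σ ⟶ adQuotient i σ :=
  fiberProductSnd.{u + 1, u, u + 1, u + 2} (adMap i σ) (adMap i σ)

/-- The canonical map `[1, ·] : P → f(P)` from a `K`-torsor to the associated `G`-torsor. -/
noncomputable def toAdMap (i : K ⟶ G) [IsMonHom i] (σ : G ⟶ G) [IsMonHom σ]
    (Q : QuotObj (adAction i σ)) {U : Over (Spec (.of k))} (p : Q.P.obj (op U)) :
    (indObj (inclusionAction i σ) Q).P.obj (op U) :=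
  (toInd (inclusionAction i σ) Q).map U p

/-- The canonical map `[1, ·] : P → m(P)` from a `K × K`-torsor to the associated `K`-torsor. -/
noncomputable def toMultMap (i : K ⟶ G) [IsMonHom i] (σ : G ⟶ G) [IsMonHom σ]
    (Q : QuotObj (adAction₂ i σ)) {U : Over (Spec (.of k))} (p : Q.P.obj (op U)) :
    (indObj (multAction i σ) Q).P.obj (op U) :=
  (toInd (multAction i σ) Q).map U p

/-- The canonical map `[1, ·]` from a `K × K`-torsor `P` to its image under the partial `σ`-map. -/
noncomputable def toPartialMap (i : K ⟶ G) [IsMonHom i] (σ : G ⟶ G) [IsMonHom σ]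
    (σK : K ⟶ K) [IsMonHom σK] (hσK : σK ≫ i = i ≫ σ)
    (Q : QuotObj (adAction₂ i σ)) {U : Over (Spec (.of k))} (p : Q.P.obj (op U)) :
    (indObj (partialAction i σ σK hσK) Q).P.obj (op U) :=
  (toInd (partialAction i σ σK hσK) Q).map U p

open Bicategory in
/-- Let `e : X ×_Y X ⟶ X₂` be a morphism, and let `α` and `β` identify the left projection with the
partial `σ`-map followed by multiplication, and the right projection with multiplication. These
data are canonical if, for every object `c = (x, y, ι : f x ≅ f y)` of `X ×_Y X`, the isomorphism
`ι` of `G`-torsors becomes multiplication by `g₂` on the `K × K`-torsor `P` of `e(c)`, whose map to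
`G × G` is `(g₁, g₂)`. (Note that `σ(g₂) g₁ = σ(g₂) (g₁ g₂) g₂⁻¹`.) By the universal property of
the 2-fibre product, this determines an equivalence `e` together with `α` and `β` up to unique
isomorphism. -/
def IsCanonical (i : K ⟶ G) [IsMonHom i] (σ : G ⟶ G) [IsMonHom σ]
    (σK : K ⟶ K) [IsMonHom σK] (hσK : σK ≫ i = i ≫ σ)
    (e : adFiberProduct i σ ⟶ adQuotient₂ i σ)
    (α : leftProjection i σ ≅ e ≫ partialMap i σ σK hσK ≫ multMap i σ)
    (β : rightProjection i σ ≅ e ≫ multMap i σ) : Prop :=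
  ∀ (c : FiberProductObj (adMap i σ) (adMap i σ)) (U : Over (Spec (.of k)))
    (p : (QuotObj.P (e.obj c)).obj (op U)),
    QuotHom.map c.iso.hom U (toAdMap i σ c.fst
        (QuotHom.map (α.inv.toNatTrans.app c) U
          (toMultMap i σ _ (toPartialMap i σ σK hσK (e.obj c) p)))) =
      secondCoordinate (e.obj c) p •
        toAdMap i σ c.snd (QuotHom.map (β.inv.toNatTrans.app c) U (toMultMap i σ (e.obj c) p))

end Groups

end QuotientStack

/-! A `T`-point of the 2-fibre product consists of two `K`-torsors `Q`, `R` over `T` with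
equivariant maps `z` to `G`, and an isomorphism `τ` of the associated `G`-torsors. Given local
sections `q`, `r` over the same point, there is a unique `g` in `G` with `τ [1, q] = g [1, r]`.
Replacing `(q, r)` by `(a q, b r)` replaces `g` by `a g b⁻¹`. Since `τ` respects the maps to `G`,
also `z(q) = σ(g) z(r) g⁻¹`. So put `g₂ = g` and `g₁ = z(r) g⁻¹`: then `g₁ g₂ = z(r)` and `σ(g₂) g₁
= z(q)`. The pairs `(q, r)` form a `K × K`-torsor whose map `(g₁, g₂)` to `G × G` is equivariant,
which is a point of `X₂` (`pairObj`, resting on `difference_smul_smul` and `toSpace_eq_conj`).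

Conversely, a point `P` of `X₂` has two images in `X`, under multiplication and under the partial
map followed by multiplication. The assignment `p ↦ g₂(p) [1, p]` is equivariant for the group
homomorphism `(a₁, a₂) ↦ a₂` belonging to the second image, because `(a₂ g₂ a₁⁻¹) a₁ = a₂ g₂`. It
therefore induces an isomorphism of the associated `G`-torsors (`twistedLeg`, `tautological`), and
hence a point of the 2-fibre product.

The two constructions are mutually inverse. The projections `(q, r) ↦ q` and `(q, r) ↦ r` identify
the two images of the torsor of pairs with `Q` and `R`, and `p ↦ ([1, p], [1, p])` identifies `P`
with the torsor of pairs of its images. The projections also furnish the two required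
2-isomorphisms, and canonicity is then the defining equation of `g`.

Two general facts carry the bookkeeping. A morphism of torsors over an isomorphism of bases is
invertible (`QuotHom.isIso_of_isIso_base`). Consequently any map of torsors along `φ` over such an
isomorphism has the universal property of the contracted product (`TorsorMap.exists_factor`,
`TorsorMap.hom_ext`), so that morphisms out of an image torsor can be built and compared on the
points of the original one. -/

namespace QuotientStack

/-! ### Morphisms of torsors and the recognition of contracted products. -/

section Torsors

variable {C : Type u} [Category.{v} C] {J : GrothendieckTopology C}

@[simp]
theorem QuotObj.comp_base {A : GroupAction J} {Q R S : QuotObj A} (a : Q ⟶ R) (b : R ⟶ S) :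
    (a ≫ b).base = a.base ≫ b.base := rfl

@[simp]
theorem QuotObj.comp_map {A : GroupAction J} {Q R S : QuotObj A} (a : Q ⟶ R) (b : R ⟶ S) {U : C}
    (p : Q.P.obj (op U)) : (a ≫ b).map U p = b.map U (a.map U p) := rfl

theorem QuotObj.smul_left_injective {A : GroupAction J} (Q : QuotObj A) {U : C}
    (p : Q.P.obj (op U)) {g h : A.H.obj (op U)} (e : g • p = h • p) : g = h :=
  (Q.eq_div _ p (Q.proj_smul h p).symm e).trans (Q.eq_div _ p (Q.proj_smul h p).symm rfl).symm

/-- Two points with the same image lie over the same point of the base, so they differ by a group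
element. That element fixes the common image, hence is trivial by freeness of the action on `R`. -/
theorem QuotHom.map_injective {A : GroupAction J} {Q R : QuotObj A} (a : Q ⟶ R) [IsIso a.base]
    {U : C} : Function.Injective (a.map U) := by
  intro p q e
  have hpq : Q.proj p = Q.proj q := by
    rw [← cancel_mono a.base, ← a.proj_map, ← a.proj_map, e]
  obtain ⟨h, rfl, -⟩ := Q.simplyTransitive p q hpq
  rw [a.map_smul] at e
  rw [← R.smul_left_injective (a.map U p) ((one_smul _ _).trans e), one_smul]

/-- Locally `Q` has a section over the point below `r`, and a translate of it maps to `r` by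
transitivity on `R`. Injectivity makes these local preimages independent of the section and
compatible with restriction, so `QuotObj.descend` glues them. -/
theorem QuotHom.map_surjective {A : GroupAction J} {Q R : QuotObj A} (a : Q ⟶ R) [IsIso a.base]
    {U : C} : Function.Surjective (a.map U) := by
  intro r
  let t : U ⟶ Q.base := R.proj r ≫ inv a.base
  have e : ∀ {V : C} (f : V ⟶ U) (p : Q.P.obj (op V)), Q.proj p = f ≫ t →
      R.proj (a.map V p) = R.proj (res R.P f r) := fun f p hp => by
    rw [a.proj_map, hp, R.proj_res, Category.assoc, Category.assoc, IsIso.inv_hom_id,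
      Category.comp_id]
  have lift : ∀ {V : C} (f : V ⟶ U) (p : Q.P.obj (op V)) (hp : Q.proj p = f ≫ t),
      a.map V (R.div (res R.P f r) (a.map V p) (e f p hp) • p) = res R.P f r := fun f p hp => by
    rw [a.map_smul, R.div_smul]
  obtain ⟨q, hq, -⟩ := Q.descend Q.isSheaf t
    (fun f p hp => R.div (res R.P f r) (a.map _ p) (e f p hp) • p)
    (fun g f p hp hp' => a.map_injective (by rw [lift _ _ hp', a.map_res, lift f p hp, res_comp]))
    (fun f h p hp hp' => a.map_injective (by rw [lift _ _ hp', lift f p hp]))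
  refine ⟨q, ?_⟩
  obtain ⟨S, hS, hne⟩ := Q.locallyNonempty t
  refine (R.isSheaf.isSeparated S hS).ext fun V f hf => ?_
  obtain ⟨p, hp⟩ := hne f hf
  change res R.P f (a.map U q) = res R.P f r
  rw [← a.map_res, hq f p hp, lift f p hp]

/-- A morphism of torsors over an isomorphism of the bases is an isomorphism. -/
theorem QuotHom.isIso_of_isIso_base {A : GroupAction J} {Q R : QuotObj A} (a : Q ⟶ R)
    [IsIso a.base] : IsIso a := by
  have hs := fun U : C => a.map_surjective (U := U)
  choose b hb using hs
  let c : R ⟶ Q := QuotHom.mk (inv a.base) b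
    (fun f p => a.map_injective (by rw [hb, a.map_res, hb]))
    (fun h p => a.map_injective (by rw [hb, a.map_smul, hb]))
    (fun {U} p => by rw [← cancel_mono a.base, ← a.proj_map, hb]; simp)
    (fun p => by rw [← a.toSpace_map, hb])
  exact ⟨c, QuotObj.hom_ext (IsIso.hom_inv_id _) fun U p => a.map_injective (hb U _),
    QuotObj.hom_ext (IsIso.inv_hom_id _) fun U p => hb U p⟩

/-- Composition of morphisms of group actions. -/
def ActionHom.comp {A B D : GroupAction J} (φ : ActionHom A B) (ψ : ActionHom B D) :
    ActionHom A D where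
  onGroup U := (ψ.onGroup U).comp (φ.onGroup U)
  onGroup_res f h := by simp only [MonoidHom.comp_apply, φ.onGroup_res, ψ.onGroup_res]
  onSpace U z := ψ.onSpace U (φ.onSpace U z)
  onSpace_res f z := by rw [φ.onSpace_res, ψ.onSpace_res]
  onSpace_smul h z := by rw [φ.onSpace_smul, ψ.onSpace_smul]; rfl

variable {A B D : GroupAction J} {φ : ActionHom A B} {ψ : ActionHom B D}

/-- Composition of maps of torsors along morphisms of group actions. -/
def TorsorMap.comp {Q : QuotObj A} {R : QuotObj B} {S : QuotObj D} (a : TorsorMap φ Q R)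
    (b : TorsorMap ψ R S) : TorsorMap (φ.comp ψ) Q S where
  base := a.base ≫ b.base
  map U p := b.map U (a.map U p)
  map_res f p := by rw [a.map_res, b.map_res]
  map_smul h p := by rw [a.map_smul, b.map_smul]; rfl
  proj_map p := by rw [b.proj_map, a.proj_map, Category.assoc]
  toSpace_map p := by rw [b.toSpace_map, a.toSpace_map]; rfl

variable [J.Subcanonical]

instance (Q : QuotObj A) : IsIso (toInd φ Q).base := inferInstanceAs (IsIso (𝟙 Q.base))

instance {Q : QuotObj A} {R : QuotObj B} {S : QuotObj D} (a : TorsorMap φ Q R)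
    (b : TorsorMap ψ R S) [IsIso a.base] [IsIso b.base] : IsIso (a.comp b).base :=
  inferInstanceAs (IsIso (a.base ≫ b.base))

/-- A map of torsors along `φ` over an isomorphism of the bases has the universal property of
the contracted product. -/
theorem TorsorMap.exists_factor {Q : QuotObj A} {R R' : QuotObj B} (a : TorsorMap φ Q R)
    [IsIso a.base] (b : TorsorMap φ Q R') :
    ∃ c : R ⟶ R', a.base ≫ c.base = b.base ∧
      ∀ (U : C) (p : Q.P.obj (op U)), c.map U (a.map U p) = b.map U p := by
  -- Both maps factor through the contracted product. The factor `a'` of `a` lies over an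
  -- isomorphism, hence is invertible, and the required morphism is `a'⁻¹` followed by the factor of
  -- `b`.
  obtain ⟨a', ha, ha'⟩ := a.exists_lift
  obtain ⟨b', hb, hb'⟩ := b.exists_lift
  have : IsIso a'.base := by rw [ha]; exact inferInstanceAs (IsIso a.base)
  have := a'.isIso_of_isIso_base
  have e : a' ≫ inv a' ≫ b' = b' := IsIso.hom_inv_id_assoc _ _
  refine ⟨inv a' ≫ b', ?_, fun U p => ?_⟩
  · rw [← ha, ← hb]
    exact congrArg QuotHom.base e
  · rw [← ha', ← hb', ← QuotObj.comp_map, e]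

/-- The factorization of `b` through `a`. -/
noncomputable def TorsorMap.factor {Q : QuotObj A} {R R' : QuotObj B} (a : TorsorMap φ Q R)
    [IsIso a.base] (b : TorsorMap φ Q R') : R ⟶ R' :=
  (a.exists_factor b).choose

theorem TorsorMap.base_factor {Q : QuotObj A} {R R' : QuotObj B} (a : TorsorMap φ Q R)
    [IsIso a.base] (b : TorsorMap φ Q R') : a.base ≫ (a.factor b).base = b.base :=
  (a.exists_factor b).choose_spec.1

theorem TorsorMap.factor_map {Q : QuotObj A} {R R' : QuotObj B} (a : TorsorMap φ Q R)
    [IsIso a.base] (b : TorsorMap φ Q R') {U : C} (p : Q.P.obj (op U)) :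
    (a.factor b).map U (a.map U p) = b.map U p :=
  (a.exists_factor b).choose_spec.2 U p

/-- Morphisms of torsors are determined by their composite with a map of torsors over an
isomorphism of the bases. -/
theorem TorsorMap.hom_ext {Q : QuotObj A} {R R' : QuotObj B} (a : TorsorMap φ Q R)
    [IsIso a.base] {b c : R ⟶ R'} (hb : b.base = c.base)
    (h : ∀ (U : C) (p : Q.P.obj (op U)), b.map U (a.map U p) = c.map U (a.map U p)) : b = c := by
  obtain ⟨a', ha, ha'⟩ := a.exists_lift
  have : IsIso a'.base := by rw [ha]; exact inferInstanceAs (IsIso a.base)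
  have := a'.isIso_of_isIso_base
  rw [← cancel_epi a']
  refine indObj_hom_ext (congrArg (a'.base ≫ ·) hb) fun U p => ?_
  rw [QuotObj.comp_map, QuotObj.comp_map, ha', h]

end Torsors

/-! ### Lifts of morphisms of the base, and isomorphisms in a 2-fibre product. -/

theorem quotientStack_isHomLift_iff {C : Type u} [Category.{v} C] {J : GrothendieckTopology C}
    {A : GroupAction J} {Q R : QuotObj A} {T T' : C} (t : T ⟶ T') (a : Q ⟶ R) :
    (quotientStack A).p.IsHomLift t a ↔ ∃ (hQ : Q.base = T) (hR : R.base = T'),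
      t = eqToHom hQ.symm ≫ a.base ≫ eqToHom hR :=
  ⟨fun _ => ⟨IsHomLift.domain_eq (quotientStack A).p t a,
    IsHomLift.codomain_eq (quotientStack A).p t a, IsHomLift.fac (quotientStack A).p t a⟩,
    fun ⟨hQ, hR, h⟩ => IsHomLift.of_fac (quotientStack A).p t a hQ hR h⟩

theorem quotientStack_isHomLift {C : Type u} [Category.{v} C] {J : GrothendieckTopology C}
    {A : GroupAction J} {Q R : QuotObj A} (t : Q.base ⟶ R.base) (a : Q ⟶ R) (h : a.base = t) :
    (quotientStack A).p.IsHomLift t a :=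
  (quotientStack_isHomLift_iff t a).2 ⟨rfl, rfl, by simp [h]⟩

/-- The componentwise inverses form a morphism: they lie over the inverse of the morphism of bases,
and inverting the horizontal arrows of the compatibility square gives the square they must satisfy.
-/
theorem isIso_fiberProduct {C : Type u} [Category.{v} C] {𝒳 𝒴 𝒵 : BasedCategory.{w, u'} C}
    {F : 𝒳 ⟶ 𝒵} {G : 𝒴 ⟶ 𝒵} {c d : FiberProductObj F G} (a : c ⟶ d) [IsIso a.fst] [IsIso a.snd] :
    IsIso a := by
  have := a.isHomLift
  refine ⟨FiberProductHom.mk (inv a.fst) (inv a.snd) ?_ ?_, FiberProductHom.ext ?_ ?_,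
    FiberProductHom.ext ?_ ?_⟩
  · rw [Functor.map_inv]
    infer_instance
  · rw [Functor.map_inv, Functor.map_inv, IsIso.inv_comp_eq, ← Category.assoc, a.w, Category.assoc,
      IsIso.hom_inv_id, Category.comp_id]
  · exact IsIso.hom_inv_id _
  · exact IsIso.hom_inv_id _
  · exact IsIso.inv_hom_id _
  · exact IsIso.inv_hom_id _

section TwistedConjugation

open MonObj

variable {k : Type u} [Field k] {G K : Over (Spec (.of k))} [GrpObj G] [GrpObj K]
  {i : K ⟶ G} [IsMonHom i] {σ : G ⟶ G} [IsMonHom σ]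

theorem adAction_smul {U : Over (Spec (.of k))} (a : (adAction i σ).H.obj (op U))
    (g : (adAction i σ).Z.obj (op U)) :
    a • g = ((show U ⟶ K from a) ≫ i ≫ σ) * (show U ⟶ G from g) *
      ((show U ⟶ K from a) ≫ i)⁻¹ := rfl

/-- The first component of a pair of points of `K`. -/
noncomputable def groupFst (U : Over (Spec (.of k))) :
    (adAction₂ i σ).H.obj (op U) →* (adAction i σ).H.obj (op U) :=
  MonoidHom.fst (U ⟶ K) (U ⟶ K)

/-- The second component of a pair of points of `K`. -/
noncomputable def groupSnd (U : Over (Spec (.of k))) :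
    (adAction₂ i σ).H.obj (op U) →* (adAction i σ).H.obj (op U) :=
  MonoidHom.snd (U ⟶ K) (U ⟶ K)

/-! ### The torsor of pairs attached to a morphism of associated `G`-torsors. -/

section Difference

variable {Q R : QuotObj (adAction i σ)}
  (τ : indObj (inclusionAction i σ) Q ⟶ indObj (inclusionAction i σ) R)

/-- The map of bases of a morphism of associated torsors. -/
def baseMap : Q.base ⟶ R.base := τ.base

/-- The bases of `Q` and `R` are related only through `τ`, so lying over the same point is tested
after `baseMap τ`. This is what permits dividing `τ [1, q]` by `[1, r]`. -/
theorem proj_toAdMap {U : Over (Spec (.of k))} (q : Q.P.obj (op U)) (r : R.P.obj (op U))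
    (h : Q.proj q ≫ baseMap τ = R.proj r) :
    (indObj (inclusionAction i σ) R).proj (toAdMap i σ R r) =
      (indObj (inclusionAction i σ) R).proj (τ.map U (toAdMap i σ Q q)) :=
  h.symm.trans (τ.proj_map (toAdMap i σ Q q)).symm

/-- The point `g` of `G` with `τ [1, q] = g [1, r]`. -/
noncomputable def difference {U : Over (Spec (.of k))} (q : Q.P.obj (op U)) (r : R.P.obj (op U))
    (h : Q.proj q ≫ baseMap τ = R.proj r) : (adAction (𝟙 G) σ).H.obj (op U) :=
  (indObj (inclusionAction i σ) R).div (τ.map U (toAdMap i σ Q q)) (toAdMap i σ R r)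
    (proj_toAdMap τ q r h)

theorem difference_smul {U : Over (Spec (.of k))} (q : Q.P.obj (op U)) (r : R.P.obj (op U))
    (h : Q.proj q ≫ baseMap τ = R.proj r) :
    difference τ q r h • toAdMap i σ R r = τ.map U (toAdMap i σ Q q) :=
  (indObj (inclusionAction i σ) R).div_smul _ _ _

theorem eq_difference {U : Over (Spec (.of k))} (q : Q.P.obj (op U)) (r : R.P.obj (op U))
    (h : Q.proj q ≫ baseMap τ = R.proj r) {g : (adAction (𝟙 G) σ).H.obj (op U)}
    (hg : g • toAdMap i σ R r = τ.map U (toAdMap i σ Q q)) : g = difference τ q r h :=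
  (indObj (inclusionAction i σ) R).eq_div _ _ _ hg

theorem res_difference {U V : Over (Spec (.of k))} (f : V ⟶ U) (q : Q.P.obj (op U))
    (r : R.P.obj (op U)) (h : Q.proj q ≫ baseMap τ = R.proj r)
    (h' : Q.proj (res Q.P f q) ≫ baseMap τ = R.proj (res R.P f r)) :
    difference τ (res Q.P f q) (res R.P f r) h' =
      res (adAction (𝟙 G) σ).H f (difference τ q r h) := by
  refine (eq_difference τ _ _ h' ?_).symm
  have e₁ : toAdMap i σ Q (res Q.P f q) = _ := (toInd (inclusionAction i σ) Q).map_res f q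
  have e₂ : toAdMap i σ R (res R.P f r) = _ := (toInd (inclusionAction i σ) R).map_res f r
  rw [e₁, e₂, τ.map_res]
  exact ((indObj (inclusionAction i σ) R).res_smul f _ _).symm.trans
    (congrArg _ (difference_smul τ q r h))

/-- If `τ [1, q] = g [1, r]`, then `τ [1, a q] = a g [1, r] = (a g b⁻¹) [1, b r]`; uniqueness of the
difference concludes. This is the transformation law of `g₂` in the action defining `X₂`, with `(a₁,
a₂) = (b, a)`. -/
theorem difference_smul_smul {U : Over (Spec (.of k))} (a b : (adAction i σ).H.obj (op U))
    (q : Q.P.obj (op U)) (r : R.P.obj (op U)) (h : Q.proj q ≫ baseMap τ = R.proj r)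
    (h' : Q.proj (a • q) ≫ baseMap τ = R.proj (b • r)) :
    difference τ (a • q) (b • r) h' = (inclusionAction i σ).onGroup U a * difference τ q r h *
      ((inclusionAction i σ).onGroup U b)⁻¹ := by
  refine (eq_difference τ _ _ h' ?_).symm
  have e₁ : toAdMap i σ Q (a • q) = _ := (toInd (inclusionAction i σ) Q).map_smul a q
  have e₂ : toAdMap i σ R (b • r) = _ := (toInd (inclusionAction i σ) R).map_smul b r
  rw [e₁, e₂, τ.map_smul, smul_smul, inv_mul_cancel_right, mul_smul]
  exact congrArg _ (difference_smul τ q r h)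

/-- Both `τ` and the maps `[1, ·]` respect the maps to `G`, so applying the map to `G` to `τ [1, q]
= g [1, r]` gives the relation. -/
theorem toSpace_eq_difference_smul {U : Over (Spec (.of k))} (q : Q.P.obj (op U))
    (r : R.P.obj (op U)) (h : Q.proj q ≫ baseMap τ = R.proj r) :
    (show (adAction (𝟙 G) σ).Z.obj (op U) from Q.toSpace q) =
      difference τ q r h • (show (adAction (𝟙 G) σ).Z.obj (op U) from R.toSpace r) := by
  have e₁ := (toInd (inclusionAction i σ) Q).toSpace_map q
  have e₂ := (toInd (inclusionAction i σ) R).toSpace_map r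
  have e₃ := τ.toSpace_map (toAdMap i σ Q q)
  rw [← difference_smul τ q r h, QuotObj.toSpace_smul] at e₃
  exact e₁.symm.trans (e₃.symm.trans (congrArg _ e₂))

/-- With `g₂ = g` and `g₁ = z(r) g⁻¹`, this says that `σ(g₂) g₁` is the image of `q` in `G`, which
is what makes the first projection from the torsor of pairs a torsor map. -/
theorem toSpace_eq_conj {U : Over (Spec (.of k))} (q : Q.P.obj (op U))
    (r : R.P.obj (op U)) (h : Q.proj q ≫ baseMap τ = R.proj r) :
    (show U ⟶ G from Q.toSpace q) = ((show U ⟶ G from difference τ q r h) ≫ σ) *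
      (show U ⟶ G from R.toSpace r) * (show U ⟶ G from difference τ q r h)⁻¹ := by
  refine (toSpace_eq_difference_smul τ q r h).trans ((adAction_smul _ _).trans ?_)
  rw [Category.id_comp, Category.comp_id]

/-- The sheaf of pairs of sections of two torsors over the same section of the base. -/
noncomputable def pairPresheaf : (Over (Spec (.of k)))ᵒᵖ ⥤ Type (u + 1) where
  obj U := {x : Q.P.obj (op U.unop) × R.P.obj (op U.unop) // Q.proj x.1 ≫ baseMap τ = R.proj x.2}
  map f := TypeCat.ofHom fun x => ⟨(res Q.P f.unop x.1.1, res R.P f.unop x.1.2), by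
    rw [Q.proj_res, R.proj_res, Category.assoc, x.2]⟩
  map_id U := by
    ext x
    · exact res_id Q.P _
    · exact res_id R.P _
  map_comp f g := by
    ext x
    · exact res_comp Q.P _ _ _
    · exact res_comp R.P _ _ _

theorem pairPresheaf_ext {U : Over (Spec (.of k))} {x y : (pairPresheaf τ).obj (op U)}
    (h₁ : x.1.1 = y.1.1) (h₂ : x.1.2 = y.1.2) : x = y :=
  Subtype.ext (Prod.ext h₁ h₂)

/-- The two components glue separately, and the condition relating them is local because the base of
`R` represents a separated presheaf. -/
theorem isSheaf_pairPresheaf : Presieve.IsSheaf (fpqc k) (pairPresheaf τ) := by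
  intro U S hS x hx
  obtain ⟨q, hq, hqu⟩ := Q.isSheaf S hS (fun V f hf => (x f hf).1.1)
    fun Y₁ Y₂ Z g₁ g₂ f₁ f₂ h₁ h₂ e => congrArg (fun z => z.1.1) (hx g₁ g₂ h₁ h₂ e)
  obtain ⟨r, hr, hru⟩ := R.isSheaf S hS (fun V f hf => (x f hf).1.2)
    fun Y₁ Y₂ Z g₁ g₂ f₁ f₂ h₁ h₂ e => congrArg (fun z => z.1.2) (hx g₁ g₂ h₁ h₂ e)
  have hbase : Presieve.IsSheaf (fpqc k) (yoneda.obj R.base) :=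
    GrothendieckTopology.Subcanonical.isSheaf_of_isRepresentable _
  refine ⟨⟨(q, r), (hbase.isSeparated S hS).ext fun V f hf => ?_⟩, fun V f hf => ?_, fun y hy => ?_⟩
  · have e₁ : res Q.P f q = (x f hf).1.1 := hq f hf
    have e₂ : res R.P f r = (x f hf).1.2 := hr f hf
    change f ≫ Q.proj q ≫ baseMap τ = f ≫ R.proj r
    rw [← Category.assoc, ← Q.proj_res, ← R.proj_res, e₁, e₂]
    exact (x f hf).2
  · exact pairPresheaf_ext τ (hq f hf) (hr f hf)
  · exact pairPresheaf_ext τ (hqu _ fun V f hf => congrArg (fun z => z.1.1) (hy f hf))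
      (hru _ fun V f hf => congrArg (fun z => z.1.2) (hy f hf))

/-- The components act crosswise: in `(a₁, a₂)` it is `a₂` that moves `q` and `a₁` that moves `r`.
This matches `g₂ ↦ a₂ g₂ a₁⁻¹`, and the homomorphisms to `a₂` and `a₁` on the left and right sides
of the statement. -/
noncomputable instance pairMulAction (U : Over (Spec (.of k))) :
    MulAction ((adAction₂ i σ).H.obj (op U)) ((pairPresheaf τ).obj (op U)) where
  smul a x := ⟨(groupSnd U a • x.1.1, groupFst U a • x.1.2), by
    rw [Q.proj_smul, R.proj_smul, x.2]⟩
  one_smul x := pairPresheaf_ext τ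
    ((congrArg (· • x.1.1) (map_one _)).trans (one_smul _ _))
    ((congrArg (· • x.1.2) (map_one _)).trans (one_smul _ _))
  mul_smul a b x := pairPresheaf_ext τ
    ((congrArg (· • x.1.1) (map_mul _ _ _)).trans (mul_smul _ _ _))
    ((congrArg (· • x.1.2) (map_mul _ _ _)).trans (mul_smul _ _ _))

/-- The point `(z g⁻¹, g)` of `G × G`, where `g` is the difference of `q` and `r` and `z` is the
image of `r` in `G`. -/
noncomputable def pairToSpace {U : Over (Spec (.of k))} (x : (pairPresheaf τ).obj (op U)) :
    (U ⟶ G) × (U ⟶ G) :=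
  ((show U ⟶ G from R.toSpace x.1.2) * (show U ⟶ G from difference τ x.1.1 x.1.2 x.2)⁻¹,
    difference τ x.1.1 x.1.2 x.2)

/-- The `K × K`-torsor of pairs `(q, r)` of sections of two `K`-torsors over the same section of
the base. -/
noncomputable def pairObj : QuotObj (adAction₂ i σ) where
  base := Q.base
  P := pairPresheaf τ
  isSheaf := isSheaf_pairPresheaf τ
  mulAction := pairMulAction τ
  res_smul f a x := pairPresheaf_ext τ (Q.res_smul f _ _) (R.res_smul f _ _)
  proj x := Q.proj x.1.1
  proj_res f x := Q.proj_res f _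
  proj_smul a x := Q.proj_smul _ _
  simplyTransitive {U} x y hxy := by
    obtain ⟨a, ha, hau⟩ := Q.simplyTransitive x.1.1 y.1.1 hxy
    obtain ⟨b, hb, hbu⟩ := R.simplyTransitive x.1.2 y.1.2
      (x.2.symm.trans ((congrArg (· ≫ baseMap τ) hxy).trans y.2))
    refine ⟨((b, a) : (U ⟶ K) × (U ⟶ K)), pairPresheaf_ext τ ha hb, fun c hc => ?_⟩
    exact Prod.ext (hbu _ (congrArg (fun z => z.1.2) hc)) (hau _ (congrArg (fun z => z.1.1) hc))
  locallyNonempty {U} t := by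
    obtain ⟨S, hS, hne⟩ := Q.locallyNonempty t
    -- Sections of `Q` and of `R` exist on different coverings; both exist on their intersection.
    obtain ⟨S', hS', hne'⟩ := R.locallyNonempty (t ≫ baseMap τ)
    refine ⟨S ⊓ S', (fpqc k).intersection_covering hS hS', fun V f hf => ?_⟩
    obtain ⟨q, hq⟩ := hne f hf.1
    obtain ⟨r, hr⟩ := hne' f hf.2
    exact ⟨⟨(q, r), by rw [hq, hr, Category.assoc]⟩, hq⟩
  toSpace x := pairToSpace τ x
  toSpace_res {U V} f x := by
    have e := res_difference τ f x.1.1 x.1.2 x.2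
      (by rw [Q.proj_res, R.proj_res, Category.assoc, x.2])
    refine Prod.ext ?_ e
    refine (congrArg₂ (fun a b : V ⟶ G => a * b⁻¹) (R.toSpace_res f x.1.2) e).trans ?_
    change (f ≫ (show U ⟶ G from R.toSpace x.1.2)) *
      (f ≫ (show U ⟶ G from difference τ x.1.1 x.1.2 x.2))⁻¹ = f ≫ (_ * _)
    rw [MonObj.comp_mul, GrpObj.comp_inv]
  toSpace_smul {U} a x := by
    have e := difference_smul_smul τ (groupSnd U a) (groupFst U a) x.1.1 x.1.2 x.2 (a • x).2
    refine Prod.ext ?_ e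
    refine (congrArg₂ (fun a b : U ⟶ G => a * b⁻¹) (R.toSpace_smul (groupFst U a) x.1.2) e).trans ?_
    -- Here `b` and `c` are the images in `G` of the first and second components of the group
    -- element, `a = σ(b)`, `z` is the image of `r` and `d` the difference. The factor `b` cancels,
    -- leaving the required `σ(a₁) g₁ a₂⁻¹`.
    have key : ∀ a b c z d : U ⟶ G, (a * z * b⁻¹) * (c * d * b⁻¹)⁻¹ = a * (z * d⁻¹) * c⁻¹ :=
      fun a b c z d => by group
    exact key _ _ _ _ _

end Difference

/-! ### The two images in `X` of an object of `X₂` and the tautological isomorphism. -/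

section Legs

variable (i σ)

/-- The canonical map of torsors from an object of `X₂` to its image under multiplication. -/
noncomputable def rightLeg (Q : QuotObj (adAction₂ i σ)) :
    TorsorMap (multAction i σ) Q (indObj (multAction i σ) Q) :=
  toInd (multAction i σ) Q

/-- The canonical map from an object of `X₂` to the `G`-torsor associated to its image under
multiplication. -/
noncomputable def rightLegAd (Q : QuotObj (adAction₂ i σ)) :
    TorsorMap ((multAction i σ).comp (inclusionAction i σ)) Q
      (indObj (inclusionAction i σ) (indObj (multAction i σ) Q)) :=
  (rightLeg i σ Q).comp (toInd (inclusionAction i σ) _)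

variable (σK : K ⟶ K) [IsMonHom σK] (hσK : σK ≫ i = i ≫ σ)

/-- The canonical map of torsors from an object of `X₂` to its image under the partial `σ`-map
followed by multiplication. -/
noncomputable def leftLeg (Q : QuotObj (adAction₂ i σ)) :
    TorsorMap ((partialAction i σ σK hσK).comp (multAction i σ)) Q
      (indObj (multAction i σ) (indObj (partialAction i σ σK hσK) Q)) :=
  (toInd (partialAction i σ σK hσK) Q).comp (toInd (multAction i σ) _)

/-- The canonical map from an object of `X₂` to the `G`-torsor associated to its image under the
partial `σ`-map followed by multiplication. -/
noncomputable def leftLegAd (Q : QuotObj (adAction₂ i σ)) :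
    TorsorMap (((partialAction i σ σK hσK).comp (multAction i σ)).comp (inclusionAction i σ)) Q
      (indObj (inclusionAction i σ)
        (indObj (multAction i σ) (indObj (partialAction i σ σK hσK) Q))) :=
  (leftLeg i σ σK hσK Q).comp (toInd (inclusionAction i σ) _)

instance (Q : QuotObj (adAction₂ i σ)) : IsIso (rightLeg i σ Q).base :=
  inferInstanceAs (IsIso (toInd (multAction i σ) Q).base)

instance (Q : QuotObj (adAction₂ i σ)) : IsIso (leftLeg i σ σK hσK Q).base :=
  inferInstanceAs (IsIso ((toInd (partialAction i σ σK hσK) Q).comp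
    (toInd (multAction i σ) _)).base)

instance (Q : QuotObj (adAction₂ i σ)) : IsIso (leftLegAd i σ σK hσK Q).base :=
  inferInstanceAs (IsIso ((leftLeg i σ σK hσK Q).comp (toInd (inclusionAction i σ) _)).base)

theorem leftLeg_base (Q : QuotObj (adAction₂ i σ)) : (leftLeg i σ σK hσK Q).base = 𝟙 Q.base :=
  Category.comp_id _

theorem leftLegAd_base (Q : QuotObj (adAction₂ i σ)) :
    (leftLegAd i σ σK hσK Q).base = 𝟙 Q.base :=
  (Category.comp_id _).trans (Category.comp_id _)

variable {i σ}

theorem secondCoordinate_smul (Q : QuotObj (adAction₂ i σ)) {U : Over (Spec (.of k))}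
    (a : (adAction₂ i σ).H.obj (op U)) (p : Q.P.obj (op U)) :
    secondCoordinate Q (a • p) = (inclusionAction i σ).onGroup U (groupSnd U a) *
      secondCoordinate Q p * ((inclusionAction i σ).onGroup U (groupFst U a))⁻¹ :=
  congrArg Prod.snd (Q.toSpace_smul a p)

theorem secondCoordinate_res (Q : QuotObj (adAction₂ i σ)) {U V : Over (Spec (.of k))}
    (f : V ⟶ U) (p : Q.P.obj (op U)) :
    secondCoordinate Q (res Q.P f p) = res (adAction (𝟙 G) σ).H f (secondCoordinate Q p) :=
  congrArg Prod.snd (Q.toSpace_res f p)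

/-- The map `p ↦ g₂(p) [1, p]` from an object of `X₂` to the `G`-torsor associated to its image
under multiplication. -/
noncomputable def twistedLeg (Q : QuotObj (adAction₂ i σ)) :
    TorsorMap (((partialAction i σ σK hσK).comp (multAction i σ)).comp (inclusionAction i σ)) Q
      (indObj (inclusionAction i σ) (indObj (multAction i σ) Q)) where
  base := 𝟙 Q.base
  map U p := secondCoordinate Q p • (rightLegAd i σ Q).map U p
  map_res f p := by
    rw [(rightLegAd i σ Q).map_res, QuotObj.res_smul, secondCoordinate_res]
  map_smul {U} a p := by
    -- Translating `p` by `(a₁, a₂)` multiplies `[1, p]` by `a₁` and turns `g₂` into `a₂ g₂ a₁⁻¹`.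
    -- The `a₁` cancels, so the twisted map is equivariant along `(a₁, a₂) ↦ a₂`.
    rw [(rightLegAd i σ Q).map_smul, secondCoordinate_smul, smul_smul, smul_smul]
    refine congrArg (· • (rightLegAd i σ Q).map U p) ?_
    exact inv_mul_cancel_right _ _
  proj_map p := by
    rw [QuotObj.proj_smul, (rightLegAd i σ Q).proj_map]
    exact congrArg _ (Category.comp_id _)
  toSpace_map {U} p := by
    rw [QuotObj.toSpace_smul, (rightLegAd i σ Q).toSpace_map]
    -- With `x = g₁` and `y = g₂`, this is `σ(g₂) (g₁ g₂) g₂⁻¹ = σ(g₂) g₁`.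
    have key : ∀ x y : U ⟶ G, ((y ≫ 𝟙 G ≫ σ) * (x * y) * (y ≫ 𝟙 G)⁻¹ : U ⟶ G) = (y ≫ σ) * x :=
      fun x y => by
        rw [Category.id_comp, Category.comp_id]
        group
    exact key (show (U ⟶ G) × (U ⟶ G) from Q.toSpace p).1 _

/-- The tautological morphism of the two `G`-torsors associated to an object of `X₂`. -/
noncomputable def tautological (Q : QuotObj (adAction₂ i σ)) :
    indObj (inclusionAction i σ) (indObj (multAction i σ) (indObj (partialAction i σ σK hσK) Q)) ⟶
      indObj (inclusionAction i σ) (indObj (multAction i σ) Q) :=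
  (leftLegAd i σ σK hσK Q).factor (twistedLeg σK hσK Q)

theorem tautological_base (Q : QuotObj (adAction₂ i σ)) :
    (tautological σK hσK Q).base = 𝟙 Q.base := by
  have h := (leftLegAd i σ σK hσK Q).base_factor (twistedLeg σK hσK Q)
  rw [leftLegAd_base] at h
  exact (Category.id_comp _).symm.trans h

theorem tautological_map (Q : QuotObj (adAction₂ i σ)) {U : Over (Spec (.of k))}
    (p : Q.P.obj (op U)) :
    (tautological σK hσK Q).map U (toAdMap i σ _ ((leftLeg i σ σK hσK Q).map U p)) =
      secondCoordinate Q p • toAdMap i σ _ ((rightLeg i σ Q).map U p) :=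
  (leftLegAd i σ σK hσK Q).factor_map (twistedLeg σK hσK Q) p

instance (Q : QuotObj (adAction₂ i σ)) : IsIso (tautological σK hσK Q) := by
  have : IsIso (tautological σK hσK Q).base := by
    rw [tautological_base]
    exact inferInstanceAs (IsIso (𝟙 Q.base))
  exact QuotHom.isIso_of_isIso_base _

theorem partialMult_map_leftLeg {Q R : QuotObj (adAction₂ i σ)} (a : Q ⟶ R)
    {U : Over (Spec (.of k))} (p : Q.P.obj (op U)) :
    (indMap (multAction i σ) (indMap (partialAction i σ σK hσK) a)).map U
      ((leftLeg i σ σK hσK Q).map U p) = (leftLeg i σ σK hσK R).map U (a.map U p) :=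
  (indMap_toInd (multAction i σ) _ U _).trans
    (congrArg _ (indMap_toInd (partialAction i σ σK hσK) a U p))

theorem partialMult_base {Q R : QuotObj (adAction₂ i σ)} (a : Q ⟶ R) :
    (indMap (multAction i σ) (indMap (partialAction i σ σK hσK) a)).base = a.base :=
  (indMap_base _ _).trans (indMap_base _ _)

theorem mult_map_rightLeg {Q R : QuotObj (adAction₂ i σ)} (a : Q ⟶ R)
    {U : Over (Spec (.of k))} (p : Q.P.obj (op U)) :
    (indMap (multAction i σ) a).map U ((rightLeg i σ Q).map U p) =
      (rightLeg i σ R).map U (a.map U p) :=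
  indMap_toInd (multAction i σ) _ U _

theorem indMap_toAdMap {Q R : QuotObj (adAction i σ)} (a : Q ⟶ R)
    {U : Over (Spec (.of k))} (p : Q.P.obj (op U)) :
    (indMap (inclusionAction i σ) a).map U (toAdMap i σ Q p) = toAdMap i σ R (a.map U p) :=
  indMap_toInd (inclusionAction i σ) _ U _

/-- It suffices to compare on the points coming from `Q`. There one side gives `g₂(a p) [1, a p]`
and the other `g₂(p) [1, a p]`, and `a` preserves the map to `G × G`. -/
theorem tautological_naturality {Q R : QuotObj (adAction₂ i σ)} (a : Q ⟶ R) :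
    indMap (inclusionAction i σ) (indMap (multAction i σ) (indMap (partialAction i σ σK hσK) a)) ≫
        tautological σK hσK R =
      tautological σK hσK Q ≫ indMap (inclusionAction i σ) (indMap (multAction i σ) a) := by
  refine (leftLegAd i σ σK hσK Q).hom_ext ?_ fun U p => ?_
  · rw [QuotObj.comp_base, QuotObj.comp_base, indMap_base, indMap_base, indMap_base, indMap_base,
      indMap_base, tautological_base, tautological_base]
    exact (Category.comp_id _).trans (Category.id_comp _).symm
  · rw [QuotObj.comp_map, QuotObj.comp_map]
    change (tautological σK hσK R).map U ((indMap (inclusionAction i σ) _).map U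
        (toAdMap i σ _ ((leftLeg i σ σK hσK Q).map U p))) =
      (indMap (inclusionAction i σ) _).map U ((tautological σK hσK Q).map U
        (toAdMap i σ _ ((leftLeg i σ σK hσK Q).map U p)))
    rw [indMap_toAdMap, partialMult_map_leftLeg, tautological_map, tautological_map,
      QuotHom.map_smul, indMap_toAdMap, mult_map_rightLeg]
    refine congrArg (· • _) (congrArg Prod.snd (a.toSpace_map p))

end Legs

/-! ### Functoriality and projections of the torsor of pairs. -/

section Pairs

variable {Q R Q' R' : QuotObj (adAction i σ)}
  {τ : indObj (inclusionAction i σ) Q ⟶ indObj (inclusionAction i σ) R}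
  {τ' : indObj (inclusionAction i σ) Q' ⟶ indObj (inclusionAction i σ) R'}

theorem base_comm (a : Q ⟶ Q') (b : R ⟶ R')
    (w : indMap (inclusionAction i σ) a ≫ τ' = τ ≫ indMap (inclusionAction i σ) b) :
    a.base ≫ baseMap τ' = baseMap τ ≫ b.base := by
  have := congrArg QuotHom.base w
  rwa [QuotObj.comp_base, QuotObj.comp_base, indMap_base, indMap_base] at this

/-- Pairs of sections are functorial. -/
noncomputable def pairMap (a : Q ⟶ Q') (b : R ⟶ R')
    (w : indMap (inclusionAction i σ) a ≫ τ' = τ ≫ indMap (inclusionAction i σ) b) :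
    pairObj τ ⟶ pairObj τ' := by
  have hmem : ∀ {U : Over (Spec (.of k))} (x : (pairPresheaf τ).obj (op U)),
      Q'.proj (a.map U x.1.1) ≫ baseMap τ' = R'.proj (b.map U x.1.2) := fun x => by
    rw [a.proj_map, b.proj_map, Category.assoc, base_comm a b w, ← x.2, Category.assoc]
  -- Applying the morphism induced by `b` to `τ [1, q] = g [1, r]` and using `w` gives `τ' [1, a q]
  -- = g [1, b r]`. So the difference, and with it the map to `G × G`, is unchanged.
  have hdiff : ∀ {U : Over (Spec (.of k))} (x : (pairPresheaf τ).obj (op U)),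
      difference τ' (a.map U x.1.1) (b.map U x.1.2) (hmem x) =
        difference τ x.1.1 x.1.2 x.2 := fun {U} x => by
    refine (eq_difference τ' _ _ _ ?_).symm
    rw [← indMap_toAdMap, ← indMap_toAdMap, ← QuotObj.comp_map, w, QuotObj.comp_map,
      ← difference_smul τ x.1.1 x.1.2 x.2, QuotHom.map_smul]
  exact QuotHom.mk (Q := pairObj τ) (R := pairObj τ') a.base
    (fun U x => ⟨(a.map U x.1.1, b.map U x.1.2), hmem x⟩)
    (fun f x => pairPresheaf_ext τ' (a.map_res f _) (b.map_res f _))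
    (fun h x => pairPresheaf_ext τ' (a.map_smul _ _) (b.map_smul _ _))
    (fun x => a.proj_map _)
    (fun {U} x => Prod.ext (congrArg₂ (fun s t : U ⟶ G => s * t⁻¹) (b.toSpace_map _) (hdiff x))
      (hdiff x))

variable (τ)

/-- The first projection from the torsor of pairs. -/
noncomputable def pairFst (σK : K ⟶ K) [IsMonHom σK] (hσK : σK ≫ i = i ≫ σ) :
    TorsorMap ((partialAction i σ σK hσK).comp (multAction i σ)) (pairObj τ) Q where
  base := 𝟙 _
  map _ x := x.1.1
  map_res _ _ := rfl
  map_smul _ _ := rfl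
  proj_map _ := (Category.comp_id _).symm
  toSpace_map {U} x := by
    -- The target value is `σ(g₂) g₁ = σ(g) (z(r) g⁻¹)`, so the twisted conjugation formula gives it
    -- up to associativity.
    refine (toSpace_eq_conj τ x.1.1 x.1.2 x.2).trans ?_
    exact _root_.mul_assoc (G := U ⟶ G) _ _ _

/-- The second projection from the torsor of pairs. -/
noncomputable def pairSnd : TorsorMap (multAction i σ) (pairObj τ) R where
  base := baseMap τ
  map _ x := x.1.2
  map_res _ _ := rfl
  map_smul _ _ := rfl
  proj_map x := x.2.symm
  toSpace_map {U} _ := (inv_mul_cancel_right (G := U ⟶ G) _ _).symm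

end Pairs

/-! ### The functors between the 2-fibre product and `X₂`. -/

variable (i σ)

/-- The morphism `X ×_Y X ⟶ X₂` that sends `(P₁, P₂)` to the torsor of pairs. -/
noncomputable def pairFunctor : adFiberProduct i σ ⟶ adQuotient₂ i σ :=
  BasedFunctor.mk (𝒳 := adFiberProduct i σ) (𝒴 := adQuotient₂ i σ)
    { obj := fun c => pairObj (FiberProductObj.iso c).hom
      map := fun a => pairMap (FiberProductHom.fst a) (FiberProductHom.snd a)
        (FiberProductHom.w a)
      map_id := fun _ => rfl
      map_comp := fun _ _ => rfl }
    rfl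

variable (σK : K ⟶ K) [IsMonHom σK] (hσK : σK ≫ i = i ≫ σ)

variable {i σ} in
/-- The tautological isomorphism of the two `G`-torsors associated to an object of `X₂`. -/
noncomputable def tautologicalIso (Q : QuotObj (adAction₂ i σ)) :
    indObj (inclusionAction i σ) (indObj (multAction i σ) (indObj (partialAction i σ σK hσK) Q)) ≅
      indObj (inclusionAction i σ) (indObj (multAction i σ) Q) :=
  asIso (tautological σK hσK Q)

/-- The object of `X ×_Y X` associated to an object of `X₂`. -/
noncomputable def splitObj (Q : QuotObj (adAction₂ i σ)) :
    FiberProductObj (adMap i σ) (adMap i σ) where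
  fst := indObj (multAction i σ) (indObj (partialAction i σ σK hσK) Q)
  snd := indObj (multAction i σ) Q
  iso := tautologicalIso σK hσK Q
  isHomLift := quotientStack_isHomLift _ _ (tautological_base σK hσK Q)

/-- The morphism `X₂ ⟶ X ×_Y X` given by the partial `σ`-map followed by multiplication, by
multiplication, and by the tautological isomorphism. -/
noncomputable def splitFunctor : adQuotient₂ i σ ⟶ adFiberProduct i σ :=
  BasedFunctor.mk (𝒳 := adQuotient₂ i σ) (𝒴 := adFiberProduct i σ)
    { obj := fun Q => splitObj i σ σK hσK Q
      map := fun {Q R} a => FiberProductHom.mk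
        (c := splitObj i σ σK hσK Q) (d := splitObj i σ σK hσK R)
        (indMap (multAction i σ) (indMap (partialAction i σ σK hσK) a))
        (indMap (multAction i σ) a)
        (quotientStack_isHomLift _ _ ((indMap_base _ _).trans
          (partialMult_base σK hσK a).symm))
        (tautological_naturality σK hσK a)
      map_id := fun Q => FiberProductHom.ext
        ((partialMap i σ σK hσK ≫ multMap i σ).map_id Q) ((multMap i σ).map_id Q)
      map_comp := fun a b => FiberProductHom.ext
        ((partialMap i σ σK hσK ≫ multMap i σ).map_comp a b) ((multMap i σ).map_comp a b) }
    ((partialMap i σ σK hσK ≫ multMap i σ).w)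

variable {i σ}

/-! ### Recovering an object of the 2-fibre product from its torsor of pairs. -/

section Counit

variable {Q R Q' R' : QuotObj (adAction i σ)}
  (τ : indObj (inclusionAction i σ) Q ⟶ indObj (inclusionAction i σ) R)
  (τ' : indObj (inclusionAction i σ) Q' ⟶ indObj (inclusionAction i σ) R')

/-- The partial `σ`-map followed by multiplication sends a torsor of pairs to the first torsor. -/
noncomputable def pairFstHom :
    indObj (multAction i σ) (indObj (partialAction i σ σK hσK) (pairObj τ)) ⟶ Q :=
  (leftLeg i σ σK hσK _).factor (pairFst τ σK hσK)

/-- Multiplication sends a torsor of pairs to the second torsor. -/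
noncomputable def pairSndHom : indObj (multAction i σ) (pairObj τ) ⟶ R :=
  (rightLeg i σ _).factor (pairSnd τ)

theorem pairFstHom_map {U : Over (Spec (.of k))} (x : (pairPresheaf τ).obj (op U)) :
    (pairFstHom σK hσK τ).map U ((leftLeg i σ σK hσK (pairObj τ)).map U x) = x.1.1 :=
  (leftLeg i σ σK hσK _).factor_map (pairFst τ σK hσK) x

theorem pairSndHom_map {U : Over (Spec (.of k))} (x : (pairPresheaf τ).obj (op U)) :
    (pairSndHom τ).map U ((rightLeg i σ (pairObj τ)).map U x) = x.1.2 :=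
  (rightLeg i σ _).factor_map (pairSnd τ) x

theorem pairFstHom_base : (pairFstHom σK hσK τ).base = 𝟙 Q.base := by
  have h := (leftLeg i σ σK hσK _).base_factor (pairFst τ σK hσK)
  rw [leftLeg_base] at h
  exact (Category.id_comp _).symm.trans h

theorem pairSndHom_base : (pairSndHom τ).base = baseMap τ :=
  (Category.id_comp _).symm.trans ((rightLeg i σ _).base_factor (pairSnd τ))

instance : IsIso (pairFstHom σK hσK τ) := by
  have : IsIso (pairFstHom σK hσK τ).base := by
    rw [pairFstHom_base]
    exact inferInstanceAs (IsIso (𝟙 Q.base))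
  exact QuotHom.isIso_of_isIso_base _

/-- In contrast to the first projection, the second one lies over `baseMap τ` and not over an
identity, so its invertibility is drawn from that of `τ`. -/
instance [IsIso τ] : IsIso (pairSndHom τ) := by
  have : IsIso (pairSndHom τ).base := by
    rw [pairSndHom_base]
    exact ⟨(inv τ).base, congrArg QuotHom.base (IsIso.hom_inv_id τ),
      congrArg QuotHom.base (IsIso.inv_hom_id τ)⟩
  exact QuotHom.isIso_of_isIso_base _

/-- Tested on a pair `(q, r)`, the two sides are `τ [1, q]` and `g [1, r]`, equal by the definition
of the difference `g`. This is the compatibility making the two projections a morphism of the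
2-fibre product. -/
theorem pairHom_comm :
    indMap (inclusionAction i σ) (pairFstHom σK hσK τ) ≫ τ =
      tautological σK hσK (pairObj τ) ≫ indMap (inclusionAction i σ) (pairSndHom τ) := by
  refine (leftLegAd i σ σK hσK _).hom_ext ?_ fun U x => ?_
  · rw [QuotObj.comp_base, QuotObj.comp_base, indMap_base, indMap_base, pairFstHom_base,
      pairSndHom_base, tautological_base]
    exact (Category.id_comp (baseMap τ)).trans (Category.id_comp (baseMap τ)).symm
  · rw [QuotObj.comp_map, QuotObj.comp_map]
    change τ.map U ((indMap (inclusionAction i σ) _).map U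
        (toAdMap i σ _ ((leftLeg i σ σK hσK _).map U x))) =
      (indMap (inclusionAction i σ) _).map U ((tautological σK hσK _).map U
        (toAdMap i σ _ ((leftLeg i σ σK hσK _).map U x)))
    rw [indMap_toAdMap, tautological_map, QuotHom.map_smul, indMap_toAdMap]
    refine (congrArg (fun q => τ.map U (toAdMap i σ Q q)) (pairFstHom_map σK hσK τ x)).trans ?_
    refine Eq.trans ?_ (congrArg (fun r => secondCoordinate (pairObj τ) x • toAdMap i σ R r)
      (pairSndHom_map τ x)).symm
    exact (difference_smul τ x.1.1 x.1.2 x.2).symm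

variable {τ τ'}

theorem pairFstHom_naturality (a : Q ⟶ Q') (b : R ⟶ R')
    (w : indMap (inclusionAction i σ) a ≫ τ' = τ ≫ indMap (inclusionAction i σ) b) :
    indMap (multAction i σ) (indMap (partialAction i σ σK hσK) (pairMap a b w)) ≫
      pairFstHom σK hσK τ' = pairFstHom σK hσK τ ≫ a := by
  refine (leftLeg i σ σK hσK _).hom_ext ?_ fun U x => ?_
  · rw [QuotObj.comp_base, QuotObj.comp_base, partialMult_base, pairFstHom_base, pairFstHom_base]
    exact (Category.comp_id a.base).trans (Category.id_comp a.base).symm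
  · rw [QuotObj.comp_map, QuotObj.comp_map, partialMult_map_leftLeg]
    exact (pairFstHom_map σK hσK τ' _).trans
      (congrArg (a.map U) (pairFstHom_map σK hσK τ x)).symm

theorem pairSndHom_naturality (a : Q ⟶ Q') (b : R ⟶ R')
    (w : indMap (inclusionAction i σ) a ≫ τ' = τ ≫ indMap (inclusionAction i σ) b) :
    indMap (multAction i σ) (pairMap a b w) ≫ pairSndHom τ' = pairSndHom τ ≫ b := by
  refine (rightLeg i σ _).hom_ext ?_ fun U x => ?_
  · rw [QuotObj.comp_base, QuotObj.comp_base, indMap_base, pairSndHom_base, pairSndHom_base]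
    exact base_comm a b w
  · rw [QuotObj.comp_map, QuotObj.comp_map, mult_map_rightLeg]
    exact (pairSndHom_map τ' _).trans (congrArg (b.map U) (pairSndHom_map τ x)).symm

/-- The isomorphism `pairFstHom`. -/
noncomputable def pairFstIso (τ : indObj (inclusionAction i σ) Q ⟶ indObj (inclusionAction i σ) R) :
    indObj (multAction i σ) (indObj (partialAction i σ σK hσK) (pairObj τ)) ≅ Q :=
  asIso (pairFstHom σK hσK τ)

/-- The isomorphism `pairSndHom`. -/
noncomputable def pairSndIso (τ : indObj (inclusionAction i σ) Q ≅ indObj (inclusionAction i σ) R) :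
    indObj (multAction i σ) (pairObj τ.hom) ≅ R :=
  asIso (pairSndHom τ.hom)

variable (c : FiberProductObj (adMap i σ) (adMap i σ))

/-- The bases of `c.fst` and `c.snd` are only propositionally equal. Since `pairSndHom` and
`c.iso.hom` have the same underlying map of bases, the lifting property of the latter carries over.
-/
theorem pairSndHom_isHomLift :
    (adQuotient i σ).p.IsHomLift (𝟙 (QuotObj.base c.fst))
      (pairSndHom (Q := c.fst) (R := c.snd) c.iso.hom) := by
  obtain ⟨h, h', e⟩ := (quotientStack_isHomLift_iff _ _).1 c.isHomLift
  refine (quotientStack_isHomLift_iff _ _).2 ⟨h, h', ?_⟩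
  exact e.trans (congrArg (fun z => eqToHom _ ≫ z ≫ eqToHom _)
    (pairSndHom_base (Q := c.fst) (R := c.snd) c.iso.hom).symm)

/-- An object of `X ×_Y X` is recovered from its torsor of pairs. -/
noncomputable def splitPair :
    splitObj i σ σK hσK (pairObj (Q := c.fst) (R := c.snd) c.iso.hom) ⟶ c :=
  FiberProductHom.mk
    (c := splitObj i σ σK hσK (pairObj (Q := c.fst) (R := c.snd) c.iso.hom)) (d := c)
    (pairFstHom σK hσK (Q := c.fst) (R := c.snd) c.iso.hom)
    (pairSndHom (Q := c.fst) (R := c.snd) c.iso.hom)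
    (by
      have e : (adQuotient i σ).p.map (pairFstHom σK hσK (Q := c.fst) (R := c.snd) c.iso.hom) =
        𝟙 (QuotObj.base c.fst) := pairFstHom_base σK hσK _
      exact e ▸ pairSndHom_isHomLift c)
    (pairHom_comm σK hσK (Q := c.fst) (R := c.snd) c.iso.hom)

/-- The isomorphism `splitPair`. -/
noncomputable def splitPairObjIso :
    splitObj i σ σK hσK (pairObj (Q := c.fst) (R := c.snd) c.iso.hom) ≅ c := by
  have : IsIso (FiberProductHom.fst (splitPair σK hσK c)) :=
    (pairFstIso σK hσK (Q := c.fst) (R := c.snd) c.iso.hom).isIso_hom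
  have : IsIso (FiberProductHom.snd (splitPair σK hσK c)) :=
    (pairSndIso (Q := c.fst) (R := c.snd) c.iso).isIso_hom
  have := isIso_fiberProduct (splitPair σK hσK c)
  exact asIso (splitPair σK hσK c)

end Counit

/-! ### Recovering an object of `X₂` as a torsor of pairs. -/

/-- An object of `X₂` is the torsor of pairs of its two images in `X`. -/
noncomputable def toPair (Q : QuotObj (adAction₂ i σ)) :
    Q ⟶ pairObj (tautological σK hσK Q) := by
  have hmem : ∀ {U : Over (Spec (.of k))} (p : Q.P.obj (op U)),
      (indObj (multAction i σ) (indObj (partialAction i σ σK hσK) Q)).proj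
        ((leftLeg i σ σK hσK Q).map U p) ≫ baseMap (tautological σK hσK Q) =
      (indObj (multAction i σ) Q).proj ((rightLeg i σ Q).map U p) := fun p => by
    refine (congrArg₂ (· ≫ ·) (((leftLeg i σ σK hσK Q).proj_map p).trans
      (congrArg _ (leftLeg_base i σ σK hσK Q))) (tautological_base σK hσK Q)).trans ?_
    exact (Category.comp_id _).trans ((rightLeg i σ Q).proj_map p).symm
  -- The tautological morphism was built so that the two legs at `p` differ by `g₂(p)`. Hence the
  -- pair of legs maps to `(g₁ g₂ g₂⁻¹, g₂) = (g₁, g₂)`, as a morphism of `X₂` requires.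
  have hdiff : ∀ {U : Over (Spec (.of k))} (p : Q.P.obj (op U)),
      difference (tautological σK hσK Q) ((leftLeg i σ σK hσK Q).map U p)
        ((rightLeg i σ Q).map U p) (hmem p) = secondCoordinate Q p := fun p =>
    (eq_difference _ _ _ _ (tautological_map σK hσK Q p).symm).symm
  exact QuotHom.mk (Q := Q) (R := pairObj (tautological σK hσK Q)) (𝟙 Q.base)
    (fun U p => ⟨((leftLeg i σ σK hσK Q).map U p, (rightLeg i σ Q).map U p), hmem p⟩)
    (fun f p => pairPresheaf_ext _ ((leftLeg i σ σK hσK Q).map_res f p)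
      ((rightLeg i σ Q).map_res f p))
    (fun a p => pairPresheaf_ext _ ((leftLeg i σ σK hσK Q).map_smul a p)
      ((rightLeg i σ Q).map_smul a p))
    (fun p => ((leftLeg i σ σK hσK Q).proj_map p).trans
      (congrArg _ (leftLeg_base i σ σK hσK Q)))
    (fun {U} p => Prod.ext
      ((congrArg₂ (fun s t : U ⟶ G => s * t⁻¹) ((rightLeg i σ Q).toSpace_map p) (hdiff p)).trans
        (mul_inv_cancel_right (G := U ⟶ G) _ _)) (hdiff p))

instance (Q : QuotObj (adAction₂ i σ)) : IsIso (toPair σK hσK Q) := by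
  have : IsIso (toPair σK hσK Q).base := inferInstanceAs (IsIso (𝟙 Q.base))
  exact QuotHom.isIso_of_isIso_base _

/-- The isomorphism `toPair`. -/
noncomputable def toPairIso (Q : QuotObj (adAction₂ i σ)) :
    Q ≅ pairObj (tautological σK hσK Q) :=
  asIso (toPair σK hσK Q)

theorem toPair_naturality {Q R : QuotObj (adAction₂ i σ)} (a : Q ⟶ R) :
    toPair σK hσK Q ≫ pairMap (indMap (multAction i σ) (indMap (partialAction i σ σK hσK) a))
        (indMap (multAction i σ) a) (tautological_naturality σK hσK a) =
      a ≫ toPair σK hσK R := by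
  refine QuotObj.hom_ext ?_ fun U p => ?_
  · refine (Category.id_comp _).trans ((partialMult_base σK hσK a).trans ?_)
    exact (Category.comp_id _).symm
  · exact pairPresheaf_ext _ (partialMult_map_leftLeg σK hσK a p) (mult_map_rightLeg a p)

/-! ### The 2-isomorphisms, canonicity and the equivalence. -/

open Bicategory

variable (i σ)

/-- `X ×_Y X ⟶ X₂ ⟶ X ×_Y X` is isomorphic to the identity. -/
noncomputable def pairSplitIso : pairFunctor i σ ≫ splitFunctor i σ σK hσK ≅ 𝟙 _ :=
  BasedNatIso.mkNatIso (𝒳 := adFiberProduct i σ) (𝒴 := adFiberProduct i σ)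
    (F := pairFunctor i σ ≫ splitFunctor i σ σK hσK) (G := 𝟙 (adFiberProduct i σ))
    (NatIso.ofComponents (fun c => splitPairObjIso σK hσK c) fun a =>
      FiberProductHom.ext (pairFstHom_naturality σK hσK (FiberProductHom.fst a)
        (FiberProductHom.snd a) (FiberProductHom.w a))
        (pairSndHom_naturality (FiberProductHom.fst a) (FiberProductHom.snd a)
          (FiberProductHom.w a)))
    fun c => by
      have e : (adFiberProduct i σ).p.map (splitPair σK hσK c) =
        𝟙 ((adFiberProduct i σ).p.obj c) := pairFstHom_base σK hσK _
      have := IsHomLift.map (adFiberProduct i σ).p (splitPair σK hσK c)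
      exact e ▸ this

/-- `X₂ ⟶ X ×_Y X ⟶ X₂` is isomorphic to the identity. -/
noncomputable def splitPairIso : 𝟙 _ ≅ splitFunctor i σ σK hσK ≫ pairFunctor i σ :=
  BasedNatIso.mkNatIso (𝒳 := adQuotient₂ i σ) (𝒴 := adQuotient₂ i σ)
    (F := 𝟙 (adQuotient₂ i σ)) (G := splitFunctor i σ σK hσK ≫ pairFunctor i σ)
    (NatIso.ofComponents (fun Q => toPairIso σK hσK Q) fun a =>
      (toPair_naturality σK hσK a).symm)
    fun _ => quotientStack_isHomLift _ _ rfl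

/-- The left projection is the partial `σ`-map followed by multiplication. -/
noncomputable def leftProjectionIso :
    pairFunctor i σ ≫ partialMap i σ σK hσK ≫ multMap i σ ≅ leftProjection i σ :=
  BasedNatIso.mkNatIso (𝒳 := adFiberProduct i σ) (𝒴 := adQuotient i σ)
    (F := pairFunctor i σ ≫ partialMap i σ σK hσK ≫ multMap i σ) (G := leftProjection i σ)
    (NatIso.ofComponents (fun c => pairFstIso σK hσK (Q := c.fst) (R := c.snd) c.iso.hom) fun a =>
      pairFstHom_naturality σK hσK (FiberProductHom.fst a) (FiberProductHom.snd a)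
        (FiberProductHom.w a))
    fun _ => quotientStack_isHomLift _ _ (pairFstHom_base σK hσK _)

/-- The right projection is multiplication. -/
noncomputable def rightProjectionIso :
    pairFunctor i σ ≫ multMap i σ ≅ rightProjection i σ :=
  BasedNatIso.mkNatIso (𝒳 := adFiberProduct i σ) (𝒴 := adQuotient i σ)
    (F := pairFunctor i σ ≫ multMap i σ) (G := rightProjection i σ)
    (NatIso.ofComponents (fun c => pairSndIso (Q := c.fst) (R := c.snd) c.iso) fun a =>
      pairSndHom_naturality (FiberProductHom.fst a) (FiberProductHom.snd a)
        (FiberProductHom.w a))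
    fun c => pairSndHom_isHomLift c

/-- The inverses of the two 2-isomorphisms send the class of a pair `(q, r)` to `q` and to `r`. The
condition becomes `τ [1, q] = g₂ [1, r]`, where `g₂` is by construction the difference of `q` and
`r`. -/
theorem isCanonical_pairFunctor : IsCanonical i σ σK hσK (pairFunctor i σ)
    (leftProjectionIso i σ σK hσK).symm (rightProjectionIso i σ).symm := by
  intro c U x
  have e₁ := pairFstHom_map σK hσK (Q := c.fst) (R := c.snd) c.iso.hom x
  have e₂ := pairSndHom_map (Q := c.fst) (R := c.snd) c.iso.hom x
  refine (congrArg (fun q => QuotHom.map c.iso.hom U (toAdMap i σ c.fst q)) e₁).trans ?_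
  refine Eq.trans ?_ (congrArg (fun r =>
    secondCoordinate (pairObj (Q := c.fst) (R := c.snd) c.iso.hom) x •
      toAdMap i σ c.snd r) e₂).symm
  exact (difference_smul (Q := c.fst) (R := c.snd) c.iso.hom x.1.1 x.1.2 x.2).symm

end TwistedConjugation

end QuotientStack
open Bicategory QuotientStack in
theorem mainTheorem8 {k : Type u} [Field k] (G K : Over (Spec (.of k))) [GrpObj G] [GrpObj K]
    [IsAffine G.left] [LocallyOfFiniteType G.hom]
    (i : K ⟶ G) [IsMonHom i] [IsClosedImmersion i.left]
    (σ : G ⟶ G) [IsMonHom σ] (hσ : IsUniversalHomeomorphism σ.left)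
    (σK : K ⟶ K) [IsMonHom σK] (hσK : σK ≫ i = i ≫ σ) :
    ∃ (e : adFiberProduct i σ ≌ adQuotient₂ i σ)
      (α : leftProjection i σ ≅ e.hom ≫ partialMap i σ σK hσK ≫ multMap i σ)
      (β : rightProjection i σ ≅ e.hom ≫ multMap i σ),
      IsCanonical i σ σK hσK e.hom α β := by
  -- Adjointification replaces the second isomorphism by one satisfying the triangle identity, so
  -- none has to be checked. The underlying morphism remains `pairFunctor`, so the 2-isomorphisms
  -- and the canonicity proved for it apply directly.
  exact ⟨Equivalence.mkOfAdjointifyCounit (pairSplitIso i σ σK hσK).symm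
    (splitPairIso i σ σK hσK).symm, (leftProjectionIso i σ σK hσK).symm,
    (rightProjectionIso i σ).symm, isCanonical_pairFunctor i σ σK hσK⟩
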